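/- Let $k,l,N\ge 1$ be integers such that $k$ or $l$ is odd. For real $\alpha,\beta$, let $W_2^{\alpha,\beta}(\mathbb{R}^2)$ be the space of tempered distributions $f$ on $\mathbb{R}^2$ whose Fourier transform $\hat f$ is a locally integrable function with $|\xi|^{\alpha}|\eta|^{\beta}\hat f(\xi,\eta)\in L^2(\mathbb{R}^2)$, with the (homogeneous) norm $\|f\|_{W_2^{\alpha,\beta}(\mathbb{R}^2)}=\big\||\xi|^{\alpha}|\eta|^{\beta}\hat f(\xi,\eta)\big\|_{L^2(\mathbb{R}^2)}$. Then there is a constant $C$, depending only on $k$, $l$ and $N$, with the following property. Let $\varphi_1,\dots,\varphi_N$ be compactly supported (complex-valued) distributions on $\mathbb{R}^2$ and $\mu_0,\dots,\mu_N$ finite compactly supported complex Borel measures on $\mathbb{R}^2$ such that, in the sense of distributions, $$-\partial_1^k\varphi_1=\mu_0;\qquad \partial_2^l\varphi_j-\partial_1^k\varphi_{j+1}=\mu_j,\quad j=1,\dots,N-1;\qquad \partial_2^l\varphi_N=\mu_N.$$ Then every $\varphi_j$ belongs to $W_2^{\frac{k-1}{2},\frac{l-1}{2}}(\mathbb{R}^2)$,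 and $$\sum_{j=1}^{N}\|\varphi_j\|_{W_2^{\frac{k-1}{2},\frac{l-1}{2}}(\mathbb{R}^2)}\le C\sum_{j=0}^{N}\|\mu_j\|,$$ where $\|\mu_j\|$ is the total variation of $\mu_j$. -/

import Mathlib

open MeasureTheory Distribution TopologicalSpace
open scoped Distributions LineDeriv SchwartzMap FourierTransform ENNReal NNReal

noncomputable section

namespace PlaneSobolev

/-- The plane `ℝ²` with its Euclidean structure. -/
abbrev Plane : Type := EuclideanSpace ℝ (Fin 2)

/-- Complex-valued distributions on the plane: the continuous linear functionals on the space
of smooth compactly supported functions. -/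
abbrev PlaneDistribution : Type := 𝓓'((⊤ : Opens Plane), ℂ)

/-- The partial derivative `∂₁ ^ k` of a distribution. -/
def partial₁ (k : ℕ) (φ : PlaneDistribution) : PlaneDistribution :=
  (fun ψ : PlaneDistribution => ∂_{(EuclideanSpace.single 0 1 : Plane)} ψ)^[k] φ

/-- The partial derivative `∂₂ ^ l` of a distribution. -/
def partial₂ (l : ℕ) (φ : PlaneDistribution) : PlaneDistribution :=
  (fun ψ : PlaneDistribution => ∂_{(EuclideanSpace.single 1 1 : Plane)} ψ)^[l] φ

/-- The distribution `φ` is compactly supported. -/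
def HasCompactDSupport (φ : PlaneDistribution) : Prop :=
  IsCompact (dsupport φ)

/-- The total variation norm `‖μ‖` of a complex measure. -/
def totalVariationNorm (μ : ComplexMeasure Plane) : ℝ≥0∞ :=
  μ.variation Set.univ

/-- The complex measure `μ` is compactly supported: it lives on a compact set. -/
def IsCompactlySupportedMeasure (μ : ComplexMeasure Plane) : Prop :=
  ∃ K : Set Plane, IsCompact K ∧ μ.variation Kᶜ = 0

/-- The distribution `φ` is equal to the complex measure `μ`: one has `φ(f) = ∫ f dμ` for every
test function `f`. -/
def EqMeasure (φ : PlaneDistribution) (μ : ComplexMeasure Plane) : Prop :=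
  ∀ f : 𝓓((⊤ : Opens Plane), ℝ), φ f = μ.integral (fun x => f x) (ContinuousLinearMap.lsmul ℝ ℝ)

/-- A real test function, viewed as a complex-valued Schwartz function. -/
def toSchwartz (f : 𝓓((⊤ : Opens Plane), ℝ)) : 𝓢(Plane, ℂ) :=
  HasCompactSupport.toSchwartzMap (f := fun x => (f x : ℂ))
    (f.hasCompactSupport.comp_left (g := Complex.ofReal) Complex.ofReal_zero)
    (Complex.ofRealCLM.contDiff.comp f.contDiff)

/-- The Fourier transform of the distribution `φ` is the locally integrable function `F`:
`φ` is (the restriction to test functions of) a tempered distribution `T`, and the tempered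
distribution `𝓕 T` is given by integration against `F`. As test functions are dense in the
Schwartz space, `T` is determined by `φ`, and `F` is determined by `φ` almost everywhere. -/
def HasFourierTransform (φ : PlaneDistribution) (F : Plane → ℂ) : Prop :=
  LocallyIntegrable F volume ∧
    ∃ T : 𝓢'(Plane, ℂ),
      (∀ f : 𝓓((⊤ : Opens Plane), ℝ), T (toSchwartz f) = φ f) ∧
      ∀ f : 𝓓((⊤ : Opens Plane), ℝ), (𝓕 T) (toSchwartz f) = ∫ ζ, (f ζ : ℂ) * F ζ

/-- The homogeneous Sobolev norm of `W₂^{α,β}(ℝ²)`, that is, the `L²` norm of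
`|ξ|^α |η|^β φ̂(ξ,η)`. The value is `∞` when `φ` is not in the space (the infimum runs over
functions that agree almost everywhere, and it is over the empty set if `φ̂` is not a function). -/
def sobolevNorm (α β : ℝ) (φ : PlaneDistribution) : ℝ≥0∞ :=
  ⨅ (F : Plane → ℂ) (_ : HasFourierTransform φ F),
    eLpNorm (fun ζ : Plane => ((|ζ 0| ^ α * |ζ 1| ^ β : ℝ) : ℂ) * F ζ) 2 volume

/-- Membership in `W₂^{α,β}(ℝ²)`. -/
def MemSobolevSpace (α β : ℝ) (φ : PlaneDistribution) : Prop :=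
  ∃ F : Plane → ℂ, HasFourierTransform φ F ∧
    MemLp (fun ζ : Plane => ((|ζ 0| ^ α * |ζ 1| ^ β : ℝ) : ℂ) * F ζ) 2 volume

end PlaneSobolev

end

open PlaneSobolev

/-! On the Fourier side the system is linear algebra. Put a = (2πiξ)^k, b = (2πiη)^l, and let m_j be
the transform of μ_j. Solving from the first equation upwards gives φ̂_j = -∑_{i<j} b^i a^(-i-1)
m_{j-1-i}; solving from the last one downwards gives φ̂_j = ∑_{i≤N-j} a^i b^(-i-1) m_{j+i}
(`eq_neg_sum_of_system`, `eq_sum_of_system`). The first formula is singular only on ξ = 0, the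
second only on η = 0. What has to be bounded is ∫ w |φ̂_j|² with w = |ξ|^(k-1) |η|^(l-1).

The dilations (s, t) = (2^(ln), 2^(kn)) scale ξ^k and η^l by the same factor. At each point off the
axes some dilate of the bump B = (x^(2kM) + y^(2lM)) e^(-x²-y²) exceeds a fixed positive constant
(`exists_le_dilationBump`), so it is enough to bound the sum over n of ∫ w |φ̂_j|² B_n, with B_n the
n-th dilate (`lintegral_le_of_bumps`). Split B as (x^(2kM) e^(-x²-y²) - E) + (y^(2lM) e^(-x²-y²) +
E), where E is divisible by both x^(2kM) and y^(2lM), and use the first formula against the first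
part and the second against the second. The denominators cancel, and there remain terms m_i
conj(m_i') times an L¹-normalised dilate s t K(s·, t·) of a Gaussian kernel
(`weight_mul_dilationBump_eq`).

Now m_i conj(m_i') is a combination of transforms of positive measures ν of mass at most ‖μ_i‖
‖μ_i'‖, and Fubini turns each integral into ∫ Q(x/s, y/t) dν with Q the transform of K. If Q
vanishes at the origin, is Lipschitz there and has first-order decay, then ∑_n |Q(x/2^(ln),
y/2^(kn))| is bounded uniformly in (x, y) (`IsDilationKernel.exists_sum_le`), which closes the
estimate. The condition Q(0, 0) = ∫ K = 0 is the purpose of E: it is a combination, with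
coefficients c_i, of Gaussians dilated by 2^i in y, and the required cancellations follow by
prescribing the values of the polynomial ∑ c_i t^i at the distinct points 2^(±l(q+1))
(`exists_interpolation`).

The passage to the Fourier side rests on two facts: a compactly supported distribution has a locally
integrable function as its transform (`exists_fourier_eq_integral`), and if it equals a measure,
that function is the transform of the measure (`HasFourierFunction.ae_eq_complexFourier`). -/

open PlaneSobolev

/-! ### Distributions vanish off their support -/

section Support

open Set

variable {E : Type*} [NormedAddCommGroup E] [NormedSpace ℝ E] [FiniteDimensional ℝ E]
  {Ω : Opens E}

/-- The product of a smooth function and a test function. -/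
noncomputable def smoothMulTest (ρ : E → ℝ) (hρ : ContDiff ℝ (⊤ : ℕ∞) ρ) (u : 𝓓(Ω, ℝ)) : 𝓓(Ω, ℝ) where
  toFun x := ρ x * u x
  contDiff' := hρ.mul u.contDiff
  hasCompactSupport' := u.hasCompactSupport.mul_left
  tsupport_subset' := (tsupport_mul_subset_right).trans u.tsupport_subset

/-- A distribution vanishes on the complement of its support. -/
theorem isVanishingOn_compl_dsupport {V : Type*} [AddCommGroup V] [Module ℝ V]
    [TopologicalSpace V] (φ : 𝓓'(Ω, V)) : IsVanishingOn φ (dsupport φ)ᶜ := by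
  intro u hu
  rw [dsupport_compl_eq, sUnion_eq_iUnion] at hu
  obtain ⟨t, ht⟩ := u.hasCompactSupport.isCompact.elim_finite_subcover _ (fun i => i.2.2) hu
  have hsub : tsupport u ⊆ ⋃ i : t, (i.1.1 : Set E) := by
    simpa [iUnion_subtype] using ht
  obtain ⟨f, hf⟩ := SmoothPartitionOfUnity.exists_isSubordinate (modelWithCornersSelf ℝ E)
    (isClosed_tsupport u) (fun i : t => (i.1.1 : Set E)) (fun i => i.1.2.2) hsub
  have hu_sum : u = ∑ i, smoothMulTest (f i) (f i).contMDiff.contDiff u := by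
    ext x
    have h1 : (∑ i, smoothMulTest (f i) (f i).contMDiff.contDiff u) x
        = ∑ i, f i x * u x := by
      exact map_sum (⟨⟨fun g : 𝓓(Ω, ℝ) => g x, rfl⟩, fun _ _ => rfl⟩ : 𝓓(Ω, ℝ) →+ ℝ) _ _
    rw [h1, ← Finset.sum_mul]
    by_cases hx : x ∈ tsupport u
    · have := f.sum_eq_one hx
      rw [finsum_eq_sum_of_fintype] at this
      rw [this, one_mul]
    · simp [image_eq_zero_of_notMem_tsupport hx]
  rw [hu_sum, map_sum]
  refine Finset.sum_eq_zero fun i _ => i.1.2.1 _ ?_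
  exact (tsupport_mul_subset_left).trans (hf i)

end Support

/-! ### Finite order on compact sets and Leibniz bounds for a cutoff -/

/-- The real test function `χ u`, for a cutoff `χ` and a smooth function `u`. -/
noncomputable def cutoffTest (χ : Plane → ℝ) (hχ : ContDiff ℝ (⊤ : ℕ∞) χ) (hχs : HasCompactSupport χ)
    (u : Plane → ℝ) (hu : ContDiff ℝ (⊤ : ℕ∞) u) : 𝓓((⊤ : Opens Plane), ℝ) where
  toFun x := χ x * u x
  contDiff' := hχ.mul hu
  hasCompactSupport' := hχs.mul_right
  tsupport_subset' := by simp

/-- Finite order on K: continuity on the functions supported in K means domination by finitely many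
of the seminorms that define their topology, and n is the largest order among these. -/
theorem exists_order_bound (φ : PlaneDistribution) (K : Compacts Plane) :
    ∃ (n : ℕ) (C : ℝ), 0 ≤ C ∧ ∀ f : 𝓓((⊤ : Opens Plane), ℝ), tsupport f ⊆ K →
      ∀ B : ℝ, 0 ≤ B → (∀ i ≤ n, ∀ x, ‖iteratedFDeriv ℝ i f x‖ ≤ B) → ‖φ f‖ ≤ C * B := by
  have hcont : Continuous fun f : 𝓓_{K}(Plane, ℝ) => φ (TestFunction.ofSupportedIn
      (Ω := (⊤ : Opens Plane)) (n := ⊤) (by simp) f) :=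
    φ.continuous.comp (TestFunction.continuous_ofSupportedIn _)
  let q : Seminorm ℝ 𝓓_{K}(Plane, ℝ) := (normSeminorm ℝ ℂ).comp
    ((φ : 𝓓((⊤ : Opens Plane), ℝ) →ₗ[ℝ] ℂ) ∘ₗ (TestFunction.ofSupportedInCLM ℝ
      (Ω := (⊤ : Opens Plane)) (n := ⊤) (K := K) (F := ℝ) (by simp)).toLinearMap)
  have hq : Continuous q := hcont.norm
  obtain ⟨s, C, -, hC⟩ := Seminorm.bound_of_continuous
    (ContDiffMapSupportedIn.withSeminorms ℝ Plane ℝ ⊤ K) q hq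
  refine ⟨s.sup id, C, C.2, fun f hf B hB hfB => ?_⟩
  let f' : 𝓓_{K}(Plane, ℝ) := .of_support_subset f.contDiff ((subset_tsupport f).trans hf)
  have h1 : q f' ≤ (C • s.sup (ContDiffMapSupportedIn.seminorm ℝ Plane ℝ ⊤ K)) f' := hC f'
  have h2 : q f' = ‖φ f‖ := rfl
  rw [← h2]
  refine h1.trans ?_
  rw [smul_apply]
  change (C : ℝ) * _ ≤ C * B
  gcongr
  refine Seminorm.finset_sup_apply_le hB fun i hi => ?_
  rw [ContDiffMapSupportedIn.seminorm_top_le_iff ℝ hB]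
  intro x _
  exact hfB i (Finset.le_sup (f := id) hi) x

theorem norm_iteratedFDeriv_cutoff_le {χ : Plane → ℝ} (hχ : ContDiff ℝ (⊤ : ℕ∞) χ)
    (hχs : HasCompactSupport χ) (n : ℕ) :
    ∃ D : ℝ, 0 ≤ D ∧ ∀ u : Plane → ℝ, ContDiff ℝ (⊤ : ℕ∞) u → ∀ B : ℝ, 0 ≤ B →
      (∀ i ≤ n, ∀ x, ‖iteratedFDeriv ℝ i u x‖ ≤ B) →
      ∀ i ≤ n, ∀ x, ‖iteratedFDeriv ℝ i (fun x => χ x * u x) x‖ ≤ D * B := by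
  have hb : ∀ i, ∃ c : ℝ, ∀ x, ‖iteratedFDeriv ℝ i χ x‖ ≤ c := fun i =>
    (hχ.continuous_iteratedFDeriv (m := i) (mod_cast le_top)).bounded_above_of_compact_support
      (hχs.iteratedFDeriv i)
  choose c hc using hb
  have hc0 : ∀ i, 0 ≤ c i := fun i => (norm_nonneg _).trans (hc i 0)
  have hD : ∀ i, 0 ≤ ∑ j ∈ Finset.range (i + 1), (i.choose j : ℝ) * c j := fun i =>
    Finset.sum_nonneg fun j _ => mul_nonneg (by positivity) (hc0 j)
  refine ⟨∑ i ∈ Finset.range (n + 1), ∑ j ∈ Finset.range (i + 1), (i.choose j : ℝ) * c j,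
    Finset.sum_nonneg fun i _ => hD i, fun u hu B hB huB i hi x => ?_⟩
  calc ‖iteratedFDeriv ℝ i (fun x => χ x * u x) x‖
      ≤ ∑ j ∈ Finset.range (i + 1), (i.choose j : ℝ) * ‖iteratedFDeriv ℝ j χ x‖ *
          ‖iteratedFDeriv ℝ (i - j) u x‖ :=
        norm_iteratedFDeriv_mul_le hχ hu x (mod_cast le_top)
    _ ≤ ∑ j ∈ Finset.range (i + 1), (i.choose j : ℝ) * c j * B := by
        gcongr with j hj
        · exact mul_nonneg (by positivity) (hc0 j)
        · exact hc j x
        · exact huB _ (by omega) x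
    _ = (∑ j ∈ Finset.range (i + 1), (i.choose j : ℝ) * c j) * B := by rw [Finset.sum_mul]
    _ ≤ _ := by
        gcongr
        exact Finset.single_le_sum (f := fun i => ∑ j ∈ Finset.range (i + 1), (i.choose j : ℝ) * c j)
          (fun i _ => hD i) (Finset.mem_range.2 (by omega))

/-! ### Extension of a distribution to Schwartz functions by a cutoff -/

section TemperedExtension

variable {χ : Plane → ℝ} (hχ : ContDiff ℝ (⊤ : ℕ∞) χ) (hχs : HasCompactSupport χ)

theorem contDiff_re (f : 𝓢(Plane, ℂ)) : ContDiff ℝ (⊤ : ℕ∞) fun x => (f x).re :=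
  Complex.reCLM.contDiff.comp (f.smooth ⊤)

theorem contDiff_im (f : 𝓢(Plane, ℂ)) : ContDiff ℝ (⊤ : ℕ∞) fun x => (f x).im :=
  Complex.imCLM.contDiff.comp (f.smooth ⊤)

/-- The linear functional `f ↦ φ (χ Re f) + i φ (χ Im f)` on Schwartz functions. -/
noncomputable def cutoffFunctional (φ : PlaneDistribution) (f : 𝓢(Plane, ℂ)) : ℂ :=
  φ (cutoffTest χ hχ hχs _ (contDiff_re f)) + Complex.I * φ (cutoffTest χ hχ hχs _ (contDiff_im f))

theorem cutoffFunctional_add (φ : PlaneDistribution) (f g : 𝓢(Plane, ℂ)) :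
    cutoffFunctional hχ hχs φ (f + g) = cutoffFunctional hχ hχs φ f + cutoffFunctional hχ hχs φ g := by
  have h1 : cutoffTest χ hχ hχs _ (contDiff_re (f + g)) =
      cutoffTest χ hχ hχs _ (contDiff_re f) + cutoffTest χ hχ hχs _ (contDiff_re g) := by
    ext x
    change χ x * ((f + g) x).re = χ x * (f x).re + χ x * (g x).re
    simp [mul_add]
  have h2 : cutoffTest χ hχ hχs _ (contDiff_im (f + g)) =
      cutoffTest χ hχ hχs _ (contDiff_im f) + cutoffTest χ hχ hχs _ (contDiff_im g) := by
    ext x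
    change χ x * ((f + g) x).im = χ x * (f x).im + χ x * (g x).im
    simp [mul_add]
  rw [cutoffFunctional, cutoffFunctional, cutoffFunctional, h1, h2, map_add, map_add]
  ring

theorem cutoffFunctional_smul (φ : PlaneDistribution) (c : ℂ) (f : 𝓢(Plane, ℂ)) :
    cutoffFunctional hχ hχs φ (c • f) = c • cutoffFunctional hχ hχs φ f := by
  have h1 : cutoffTest χ hχ hχs _ (contDiff_re (c • f)) =
      c.re • cutoffTest χ hχ hχs _ (contDiff_re f) - c.im • cutoffTest χ hχ hχs _ (contDiff_im f) := by
    ext x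
    change χ x * ((c • f) x).re = c.re * (χ x * (f x).re) - c.im * (χ x * (f x).im)
    simp; ring
  have h2 : cutoffTest χ hχ hχs _ (contDiff_im (c • f)) =
      c.re • cutoffTest χ hχ hχs _ (contDiff_im f) + c.im • cutoffTest χ hχ hχs _ (contDiff_re f) := by
    ext x
    change χ x * ((c • f) x).im = c.re * (χ x * (f x).im) + c.im * (χ x * (f x).re)
    simp; ring
  rw [cutoffFunctional, cutoffFunctional, h1, h2, map_sub, map_add, map_smul, map_smul, map_smul,
    map_smul]
  simp only [Complex.real_smul, smul_eq_mul]
  nth_rw 5 [← Complex.re_add_im c]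
  linear_combination (-(c.im : ℂ) * φ (cutoffTest χ hχ hχs _ (contDiff_im f))) * Complex.I_mul_I

theorem norm_iteratedFDeriv_clm_comp_le (L : ℂ →L[ℝ] ℝ) (hL : ‖L‖ ≤ 1) (f : 𝓢(Plane, ℂ)) (i : ℕ)
    (x : Plane) : ‖iteratedFDeriv ℝ i (fun x => L (f x)) x‖ ≤ ‖iteratedFDeriv ℝ i f x‖ := by
  refine (L.norm_iteratedFDeriv_comp_left (f := f) (n := i)
    (f.smooth i).contDiffAt le_rfl).trans ?_
  exact mul_le_of_le_one_left (norm_nonneg _) hL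

/-- No polynomial weights appear, because the cutoff confines everything to one compact set. This is
stronger than temperedness and is what later makes the Fourier transform a function. -/
theorem cutoffFunctional_bound (φ : PlaneDistribution) :
    ∃ (n : ℕ) (C : ℝ), 0 ≤ C ∧ ∀ (f : 𝓢(Plane, ℂ)) (B : ℝ), 0 ≤ B →
      (∀ i ≤ n, ∀ x, ‖iteratedFDeriv ℝ i f x‖ ≤ B) → ‖cutoffFunctional hχ hχs φ f‖ ≤ C * B := by
  obtain ⟨n, C, hC, hφ⟩ := exists_order_bound φ ⟨tsupport χ, hχs⟩
  obtain ⟨D, hD, hχD⟩ := norm_iteratedFDeriv_cutoff_le hχ hχs n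
  refine ⟨n, C * D + C * D, by positivity, fun f B hB hf => ?_⟩
  have key : ∀ (L : ℂ →L[ℝ] ℝ) (hL : ‖L‖ ≤ 1) (hu : ContDiff ℝ (⊤ : ℕ∞) fun x => L (f x)),
      ‖φ (cutoffTest χ hχ hχs _ hu)‖ ≤ C * (D * B) := by
    intro L hL hu
    refine hφ _ tsupport_mul_subset_left _ (by positivity) ?_
    exact hχD _ hu B hB fun i hi x =>
      (norm_iteratedFDeriv_clm_comp_le L hL f i x).trans (hf i hi x)
  calc ‖cutoffFunctional hχ hχs φ f‖ ≤ C * (D * B) + C * (D * B) := by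
        refine (norm_add_le _ _).trans (add_le_add ?_ ?_)
        · exact key Complex.reCLM Complex.reCLM_norm.le _
        · rw [norm_mul, Complex.norm_I, one_mul]
          exact key Complex.imCLM Complex.imCLM_norm.le _
    _ = _ := by ring

/-- The tempered distribution `χ φ`. -/
noncomputable def cutoffTempered (φ : PlaneDistribution) : 𝓢'(Plane, ℂ) :=
  ContinuousLinearMap.toPointwiseConvergenceCLM _ _ _ _
    (SchwartzMap.mkCLMtoNormedSpace (𝕜 := ℂ) (σ := RingHom.id ℂ) (cutoffFunctional hχ hχs φ)
      (cutoffFunctional_add hχ hχs φ) (cutoffFunctional_smul hχ hχs φ) (by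
        obtain ⟨n, C, hC, h⟩ := cutoffFunctional_bound hχ hχs φ
        refine ⟨(Finset.range (n + 1)).image fun i => (0, i), C, hC, fun f => ?_⟩
        refine h f _ (apply_nonneg _ _) fun i hi x => ?_
        refine (SchwartzMap.norm_iteratedFDeriv_le_seminorm ℂ f i x).trans ?_
        exact Seminorm.le_finset_sup_apply (p := schwartzSeminormFamily ℂ Plane ℂ)
          (i := ((0 : ℕ), i))
          (Finset.mem_image_of_mem _ (Finset.mem_range.2 (by omega)))))

theorem cutoffTempered_apply (φ : PlaneDistribution) (f : 𝓢(Plane, ℂ)) :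
    cutoffTempered hχ hχs φ f = φ (cutoffTest χ hχ hχs _ (contDiff_re f)) +
      Complex.I * φ (cutoffTest χ hχ hχs _ (contDiff_im f)) := rfl

theorem isVanishingOn_cutoffTempered {φ : PlaneDistribution} {U : Set Plane}
    (hU : IsVanishingOn φ U) : IsVanishingOn (cutoffTempered hχ hχs φ) U := by
  intro f hf
  rw [cutoffTempered_apply, hU, hU, mul_zero, add_zero]
  · refine tsupport_mul_subset_right.trans (Set.Subset.trans ?_ hf)
    exact tsupport_comp_subset (g := Complex.im) Complex.zero_im f
  · refine tsupport_mul_subset_right.trans (Set.Subset.trans ?_ hf)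
    exact tsupport_comp_subset (g := Complex.re) Complex.zero_re f

/-- The cutoff is 1 near every point outside U, so χf - f has its support inside U, where φ
vanishes. -/
theorem cutoffTempered_toSchwartz {φ : PlaneDistribution} {U : Set Plane}
    (hU : IsVanishingOn φ U) (hχU : ∀ x ∉ U, ∀ᶠ y in nhds x, χ y = 1)
    (f : 𝓓((⊤ : Opens Plane), ℝ)) : cutoffTempered hχ hχs φ (toSchwartz f) = φ f := by
  have h2 : cutoffTest χ hχ hχs _ (contDiff_im (toSchwartz f)) = 0 := by
    ext x
    change χ x * ((f x : ℂ)).im = 0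
    simp
  have h1 : φ (cutoffTest χ hχ hχs _ (contDiff_re (toSchwartz f)) - f) = 0 := by
    apply hU
    intro x hx
    by_contra hxU
    refine notMem_tsupport_iff_eventuallyEq.2 ?_ hx
    filter_upwards [hχU x hxU] with y hy
    change χ y * ((f y : ℂ)).re - f y = 0
    simp [hy]
  rw [cutoffTempered_apply, h2, map_zero, mul_zero, add_zero]
  rw [map_sub, sub_eq_zero] at h1
  exact h1

end TemperedExtension

/-! ### Fourier transforms that are locally integrable functions -/

section FourierOfFiniteOrder

open Real

/-- The weight `(1 + ‖ζ‖²)^r`, as a complex-valued function. -/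
noncomputable def japaneseWeight (r : ℝ) (ζ : Plane) : ℂ := (((1 + ‖ζ‖ ^ 2) ^ r : ℝ) : ℂ)

theorem japaneseWeight_hasTemperateGrowth (r : ℝ) : (japaneseWeight r).HasTemperateGrowth := by
  unfold japaneseWeight
  fun_prop

theorem japaneseWeight_mul (r s : ℝ) (ζ : Plane) :
    japaneseWeight r ζ * japaneseWeight s ζ = japaneseWeight (r + s) ζ := by
  have : (0 : ℝ) < 1 + ‖ζ‖ ^ 2 := by positivity
  rw [japaneseWeight, japaneseWeight, japaneseWeight, ← Complex.ofReal_mul, ← rpow_add this]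

theorem norm_japaneseWeight (r : ℝ) (ζ : Plane) : ‖japaneseWeight r ζ‖ = (1 + ‖ζ‖ ^ 2) ^ r := by
  rw [japaneseWeight, Complex.norm_real, norm_of_nonneg (by positivity)]

theorem norm_pow_le_japanese (ζ : Plane) {i n : ℕ} (h : i ≤ n) :
    ‖ζ‖ ^ i ≤ (1 + ‖ζ‖ ^ 2) ^ ((n : ℝ) / 2) := by
  have h1 : (1 : ℝ) ≤ 1 + ‖ζ‖ ^ 2 := by nlinarith [sq_nonneg ‖ζ‖]
  calc ‖ζ‖ ^ i = (‖ζ‖ ^ 2) ^ ((i : ℝ) / 2) := by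
        rw [← rpow_natCast, ← rpow_natCast, ← rpow_mul (norm_nonneg _)]
        congr 1
        push_cast
        ring
    _ ≤ (1 + ‖ζ‖ ^ 2) ^ ((i : ℝ) / 2) := by
        gcongr
        linarith
    _ ≤ _ := by
        apply rpow_le_rpow_of_exponent_le h1
        have : (i : ℝ) ≤ n := by exact_mod_cast h
        linarith

/-- Each derivative of the transform brings down a factor of size at most 2π‖v‖ under the integral.
Enlarging to the exponent n gives one bound for all orders up to n. -/
theorem norm_iteratedFDeriv_fourier_le (h : 𝓢(Plane, ℂ)) {i n : ℕ} (hi : i ≤ n) (x : Plane) :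
    ‖iteratedFDeriv ℝ i (𝓕 h : 𝓢(Plane, ℂ)) x‖ ≤
      (2 * π) ^ n * ∫ v, (1 + ‖v‖ ^ 2) ^ ((n : ℝ) / 2) * ‖h v‖ := by
  have hint : Integrable fun v => (1 + ‖v‖ ^ 2) ^ ((n : ℝ) / 2) * ‖h v‖ := by
    have := (SchwartzMap.smulLeftCLM ℂ (japaneseWeight ((n : ℝ) / 2)) h).integrable
      (μ := volume) |>.norm
    refine this.congr (Filter.Eventually.of_forall fun v => ?_)
    simp only
    rw [SchwartzMap.smulLeftCLM_apply_apply (japaneseWeight_hasTemperateGrowth _), norm_smul,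
      norm_japaneseWeight]
  have h1 : (1 : ℝ) ≤ 2 * π := by linarith [pi_gt_three]
  rw [SchwartzMap.fourier_coe, iteratedFDeriv_fourier (N := ⊤)
    (fun n _ => h.integrable_pow_mul volume n) h.continuous.aestronglyMeasurable le_top]
  refine (VectorFourier.norm_fourierIntegral_le_integral_norm _ _ _ _ _).trans ?_
  rw [← integral_const_mul]
  refine integral_mono_of_nonneg (Filter.Eventually.of_forall fun v => norm_nonneg _)
    (hint.const_mul _) (Filter.Eventually.of_forall fun v => ?_)
  refine (VectorFourier.norm_fourierPowSMulRight_le _ _ _ _).trans ?_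
  have hL : ‖innerSL ℝ (E := Plane)‖ ≤ 1 := norm_innerSL_le ℝ
  calc (2 * π * ‖innerSL ℝ (E := Plane)‖) ^ i * ‖v‖ ^ i * ‖h v‖
      ≤ (2 * π * 1) ^ i * (1 + ‖v‖ ^ 2) ^ ((n : ℝ) / 2) * ‖h v‖ := by
        gcongr
        exact norm_pow_le_japanese v hi
    _ ≤ (2 * π) ^ n * (1 + ‖v‖ ^ 2) ^ ((n : ℝ) / 2) * ‖h v‖ := by
        rw [mul_one]
        gcongr
    _ = _ := by ring

/-- Cauchy–Schwarz: in dimension 2 the weight (1 + ‖v‖²)⁻¹ is square integrable. -/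
theorem integral_japanese_mul_norm_le :
    ∃ D : ℝ, 0 ≤ D ∧ ∀ g : 𝓢(Plane, ℂ),
      ∫ v, (1 + ‖v‖ ^ 2) ^ (-1 : ℝ) * ‖g v‖ ≤ D * ‖g.toLp 2‖ := by
  have hk : MemLp (fun v : Plane => (1 + ‖v‖ ^ 2) ^ (-1 : ℝ)) (ENNReal.ofReal 2) := by
    rw [ENNReal.ofReal_ofNat, memLp_two_iff_integrable_sq]
    · have := integrable_rpow_neg_one_add_norm_sq (E := Plane) (μ := volume) (r := 4)
        (by simp; norm_num)
      refine this.congr (Filter.Eventually.of_forall fun v => ?_)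
      simp only
      rw [← rpow_mul_natCast (by positivity)]
      norm_num
    · refine Continuous.aestronglyMeasurable (Continuous.rpow_const (by fun_prop) fun v => ?_)
      left
      positivity
  refine ⟨(∫ v : Plane, ((1 + ‖v‖ ^ 2) ^ (-1 : ℝ)) ^ (2 : ℝ)) ^ (1 / (2 : ℝ)), by positivity,
    fun g => ?_⟩
  have hg : MemLp (fun v => ‖g v‖) (ENNReal.ofReal 2) := by
    rw [ENNReal.ofReal_ofNat]
    exact (g.memLp 2).norm
  refine (integral_mul_le_Lp_mul_Lq_of_nonneg HolderConjugate.two_two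
    (Filter.Eventually.of_forall fun v => by positivity)
    (Filter.Eventually.of_forall fun v => norm_nonneg _) hk hg).trans (le_of_eq ?_)
  rw [SchwartzMap.norm_toLp' (by norm_num) (by norm_num)]
  simp

/-- A linear functional on Schwartz functions that is bounded for the `L²` norm is given by an
`L²` function. -/
theorem exists_memLp_two_of_bounded (S : 𝓢(Plane, ℂ) →ₗ[ℂ] ℂ) (C : ℝ)
    (hS : ∀ g : 𝓢(Plane, ℂ), ‖S g‖ ≤ C * ‖g.toLp 2‖) :
    ∃ u : Plane → ℂ, MemLp u 2 volume ∧ ∀ g : 𝓢(Plane, ℂ), S g = ∫ ζ, g ζ * u ζ := by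
  let Φ : Lp ℂ 2 (volume : Measure Plane) →L[ℂ] ℂ :=
    S.extendOfNorm (SchwartzMap.toLpCLM ℂ ℂ 2 volume).toLinearMap
  have hΦ : ∀ g : 𝓢(Plane, ℂ), Φ (g.toLp 2) = S g := fun g =>
    LinearMap.extendOfNorm_eq (e := (SchwartzMap.toLpCLM ℂ ℂ 2 volume).toLinearMap)
      (SchwartzMap.denseRange_toLpCLM (by norm_num)) ⟨C, hS⟩ g
  clear_value Φ
  obtain ⟨u, rfl⟩ := (InnerProductSpace.toDual ℂ (Lp ℂ 2 (volume : Measure Plane))).surjective Φ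
  refine ⟨fun ζ => (starRingEnd ℂ) (u ζ), (Lp.memLp u).star, fun g => ?_⟩
  rw [← hΦ, InnerProductSpace.toDual_apply_apply, L2.inner_def]
  refine integral_congr_ae ?_
  filter_upwards [g.coeFn_toLp 2 volume] with ζ hζ
  rw [hζ, RCLike.inner_apply]

theorem smulLeft_japaneseWeight_apply (r : ℝ) (g : 𝓢(Plane, ℂ)) (ζ : Plane) :
    SchwartzMap.smulLeftCLM ℂ (japaneseWeight r) g ζ = japaneseWeight r ζ * g ζ :=
  SchwartzMap.smulLeftCLM_apply_apply (japaneseWeight_hasTemperateGrowth _) _ _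

theorem smulLeft_japaneseWeight_neg_cancel (r : ℝ) (g : 𝓢(Plane, ℂ)) :
    SchwartzMap.smulLeftCLM ℂ (japaneseWeight (-r))
      (SchwartzMap.smulLeftCLM ℂ (japaneseWeight r) g) = g := by
  ext ζ
  rw [smulLeft_japaneseWeight_apply, smulLeft_japaneseWeight_apply, ← mul_assoc,
    japaneseWeight_mul]
  simp [japaneseWeight]

/-- The Fourier transform of a tempered distribution that is controlled by finitely many
unweighted seminorms, such as a compactly supported one, is a locally integrable function. -/
theorem exists_fourier_eq_integral {T : 𝓢'(Plane, ℂ)} {n : ℕ} {C : ℝ} (hC : 0 ≤ C)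
    (hT : ∀ (f : 𝓢(Plane, ℂ)) (B : ℝ), 0 ≤ B →
      (∀ i ≤ n, ∀ x, ‖iteratedFDeriv ℝ i f x‖ ≤ B) → ‖T f‖ ≤ C * B) :
    ∃ F : Plane → ℂ, LocallyIntegrable F volume ∧
      ∀ g : 𝓢(Plane, ℂ), Integrable (fun ζ => g ζ * F ζ) ∧ 𝓕 T g = ∫ ζ, g ζ * F ζ := by
  -- The part n/2 absorbs the growth caused by n derivatives, and the extra 1 leaves the square
  -- integrable weight (1 + ‖v‖²)⁻¹. Thus the transform of T times the weight of exponent -r is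
  -- bounded on L², and Riesz representation applies.
  set r : ℝ := (n : ℝ) / 2 + 1 with hr
  obtain ⟨D, hD, hDg⟩ := integral_japanese_mul_norm_le
  obtain ⟨u, hu, hSu⟩ := exists_memLp_two_of_bounded
    ((𝓕 T).toLinearMap ∘ₗ (SchwartzMap.smulLeftCLM ℂ (japaneseWeight (-r))).toLinearMap)
    (C * ((2 * π) ^ n * D)) (fun g => by
      set h := SchwartzMap.smulLeftCLM ℂ (japaneseWeight (-r)) g with hh
      have h1 : ∫ v, (1 + ‖v‖ ^ 2) ^ ((n : ℝ) / 2) * ‖h v‖ =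
          ∫ v, (1 + ‖v‖ ^ 2) ^ (-1 : ℝ) * ‖g v‖ := by
        refine integral_congr_ae (Filter.Eventually.of_forall fun v => ?_)
        simp only [hh]
        rw [smulLeft_japaneseWeight_apply, norm_mul, norm_japaneseWeight, ← mul_assoc,
          ← rpow_add (by positivity)]
        congr 2
        rw [hr]
        ring
      have h2 := hT (𝓕 h) ((2 * π) ^ n * ∫ v, (1 + ‖v‖ ^ 2) ^ ((n : ℝ) / 2) * ‖h v‖)
        (mul_nonneg (by positivity) (integral_nonneg fun v => by positivity))
        fun i hi x => norm_iteratedFDeriv_fourier_le h hi x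
      rw [h1] at h2
      refine h2.trans ?_
      rw [mul_assoc, mul_assoc]
      gcongr
      exact hDg g)
  refine ⟨fun ζ => japaneseWeight r ζ * u ζ, ?_, fun g => ⟨?_, ?_⟩⟩
  · exact (hu.locallyIntegrable (by norm_num)).continuous_smul
      (japaneseWeight_hasTemperateGrowth r).1.continuous
  · refine (((SchwartzMap.smulLeftCLM ℂ (japaneseWeight r) g).memLp 2).integrable_mul hu).congr
      (Filter.Eventually.of_forall fun ζ => ?_)
    simp only [Pi.mul_apply]
    rw [smulLeft_japaneseWeight_apply]
    ring
  · have h1 := hSu (SchwartzMap.smulLeftCLM ℂ (japaneseWeight r) g)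
    rw [LinearMap.comp_apply] at h1
    have h2 := smulLeft_japaneseWeight_neg_cancel r g
    have h3 : 𝓕 T g = 𝓕 T (SchwartzMap.smulLeftCLM ℂ (japaneseWeight (-r))
      (SchwartzMap.smulLeftCLM ℂ (japaneseWeight r) g)) := by rw [h2]
    rw [h3]
    refine h1.trans (integral_congr_ae (Filter.Eventually.of_forall fun ζ => ?_))
    simp only
    rw [smulLeft_japaneseWeight_apply]
    ring

end FourierOfFiniteOrder

/-! ### Complex measures as combinations of four positive measures -/

section JordanParts

variable {X : Type*} [MeasurableSpace X]

/-- The four positive measures `ν_r` in the decomposition `μ = ν₀ + i ν₁ - ν₂ - i ν₃` of a complex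
measure. -/
noncomputable def jordanPart (μ : ComplexMeasure X) : Fin 4 → Measure X :=
  ![(ComplexMeasure.re μ).toJordanDecomposition.posPart,
    (ComplexMeasure.im μ).toJordanDecomposition.posPart,
    (ComplexMeasure.re μ).toJordanDecomposition.negPart,
    (ComplexMeasure.im μ).toJordanDecomposition.negPart]

instance isFiniteMeasure_jordanPart (μ : ComplexMeasure X) (r : Fin 4) :
    IsFiniteMeasure (jordanPart μ r) := by
  fin_cases r
  · exact (ComplexMeasure.re μ).toJordanDecomposition.posPart_finite
  · exact (ComplexMeasure.im μ).toJordanDecomposition.posPart_finite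
  · exact (ComplexMeasure.re μ).toJordanDecomposition.negPart_finite
  · exact (ComplexMeasure.im μ).toJordanDecomposition.negPart_finite

theorem totalVariation_re_le (μ : ComplexMeasure X) :
    (ComplexMeasure.re μ).totalVariation ≤ μ.variation := by
  rw [SignedMeasure.totalVariation_eq_variation]
  refine VectorMeasure.variation_le_of_forall_enorm_le fun s _ => ?_
  refine le_trans ?_ (μ.enorm_measure_le_variation s)
  rw [enorm_le_iff_norm_le]
  exact Complex.abs_re_le_norm (μ s)

theorem totalVariation_im_le (μ : ComplexMeasure X) :
    (ComplexMeasure.im μ).totalVariation ≤ μ.variation := by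
  rw [SignedMeasure.totalVariation_eq_variation]
  refine VectorMeasure.variation_le_of_forall_enorm_le fun s _ => ?_
  refine le_trans ?_ (μ.enorm_measure_le_variation s)
  rw [enorm_le_iff_norm_le]
  exact Complex.abs_im_le_norm (μ s)

theorem jordanPart_le_variation (μ : ComplexMeasure X) (r : Fin 4) :
    jordanPart μ r ≤ μ.variation := by
  have h1 := totalVariation_re_le μ
  have h2 := totalVariation_im_le μ
  rw [SignedMeasure.totalVariation] at h1 h2
  fin_cases r
  · exact le_trans (Measure.le_add_right le_rfl) h1
  · exact le_trans (Measure.le_add_right le_rfl) h2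
  · exact le_trans (Measure.le_add_left le_rfl) h1
  · exact le_trans (Measure.le_add_left le_rfl) h2

theorem apply_eq_sum_jordanPart (μ : ComplexMeasure X) {s : Set X} (hs : MeasurableSet s) :
    μ s = ∑ r : Fin 4, Complex.I ^ (r : ℕ) * ((jordanPart μ r).real s : ℂ) := by
  have h1 := (ComplexMeasure.re μ).apply_eq_posPart_real_sub_negPart_real hs
  have h2 := (ComplexMeasure.im μ).apply_eq_posPart_real_sub_negPart_real hs
  rw [ComplexMeasure.re_apply] at h1
  rw [ComplexMeasure.im_apply] at h2
  have h1' : (μ s).re = _ := h1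
  have h2' : (μ s).im = _ := h2
  rw [Fin.sum_univ_four, ← Complex.re_add_im (μ s), h1', h2']
  simp [jordanPart, pow_succ]
  ring

/-- This supplies the finiteness of the variation. -/
theorem variation_le_sum_jordanPart (μ : ComplexMeasure X) :
    μ.variation ≤ ∑ r : Fin 4, jordanPart μ r := by
  refine VectorMeasure.variation_le_of_forall_enorm_le fun s hs => ?_
  rw [apply_eq_sum_jordanPart μ hs, Measure.finsetSum_apply]
  refine (enorm_sum_le _ _).trans (Finset.sum_le_sum fun r _ => ?_)
  rw [enorm_mul, enorm_pow]
  have h1 : ‖Complex.I‖ₑ = 1 := by simp [← ofReal_norm]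
  rw [h1, one_pow, one_mul, ← ofReal_norm, Complex.norm_real, Real.norm_of_nonneg measureReal_nonneg,
    ofReal_measureReal]

instance isFiniteMeasure_variation (μ : ComplexMeasure X) : IsFiniteMeasure μ.variation :=
  isFiniteMeasure_of_le _ (variation_le_sum_jordanPart μ)

theorem continuous_integral_of_le {ν V : Measure X} (h : ν ≤ V) :
    Continuous fun f : X →₁[V] ℝ => ∫ x, f x ∂ν := by
  refine LipschitzWith.continuous (K := 1) (LipschitzWith.of_dist_le_mul fun f g => ?_)
  have hf := L1.integrable_coeFn f
  have hg := L1.integrable_coeFn g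
  rw [dist_eq_norm, ← integral_sub (hf.mono_measure h) (hg.mono_measure h), NNReal.coe_one, one_mul,
    dist_eq_norm, L1.norm_eq_integral_norm]
  refine (norm_integral_le_integral_norm _).trans ?_
  refine (integral_mono_measure h (Filter.Eventually.of_forall fun x => norm_nonneg _)
    (hf.sub hg).norm).trans (le_of_eq ?_)
  refine integral_congr_ae ?_
  filter_upwards [Lp.coeFn_sub f g] with x hx
  rw [hx, Pi.sub_apply]

/-- Both sides agree on indicators, are additive, and are continuous in L¹ of the variation, which
dominates every Jordan part. The formula reduces integration against μ to positive measures, where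
characteristic functions are available. -/
theorem integral_eq_sum_jordanPart (μ : ComplexMeasure X) {f : X → ℝ}
    (hf : Integrable f μ.variation) :
    μ.integral f (ContinuousLinearMap.lsmul ℝ ℝ) =
      ∑ r : Fin 4, Complex.I ^ (r : ℕ) * ((∫ x, f x ∂(jordanPart μ r) : ℝ) : ℂ) := by
  have hle := jordanPart_le_variation μ
  refine Integrable.induction (P := fun f : X → ℝ => μ.integral f (ContinuousLinearMap.lsmul ℝ ℝ) =
      ∑ r : Fin 4, Complex.I ^ (r : ℕ) * ((∫ x, f x ∂(jordanPart μ r) : ℝ) : ℂ)) ?_ ?_ ?_ ?_ hf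
  · intro c s hs _
    have h1 : μ.integral (s.indicator fun _ => c) (ContinuousLinearMap.lsmul ℝ ℝ) = c • μ s := by
      rw [VectorMeasure.integral_eq_setToFun]
      rw [setToFun_indicator_const _ hs (measure_ne_top _ _) c]
      rfl
    change μ.integral (s.indicator fun _ => c) _ = _
    rw [h1, apply_eq_sum_jordanPart μ hs, Finset.smul_sum]
    refine Finset.sum_congr rfl fun r _ => ?_
    have h2 : ∫ x, s.indicator (fun _ => c) x ∂(jordanPart μ r) = (jordanPart μ r).real s * c := by
      rw [integral_indicator_const c hs, smul_eq_mul]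
    rw [h2, Complex.real_smul]
    push_cast
    ring
  · intro f g _ hf hg hPf hPg
    have h1 := VectorMeasure.integral_fun_add (B := (ContinuousLinearMap.lsmul ℝ ℝ : ℝ →L[ℝ] ℂ →L[ℝ] ℂ))
      hf hg
    change μ.integral (fun x => f x + g x) _ = _
    rw [h1, hPf, hPg, ← Finset.sum_add_distrib]
    refine Finset.sum_congr rfl fun r _ => ?_
    have := integral_add (hf.mono_measure (hle r)) (hg.mono_measure (hle r))
    simp only [Pi.add_apply]
    rw [this]
    push_cast
    ring
  · refine isClosed_eq VectorMeasure.continuous_integral ?_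
    refine continuous_finsetSum _ fun r _ => continuous_const.mul ?_
    exact Complex.continuous_ofReal.comp (continuous_integral_of_le (hle r))
  · intro f g hfg _ hPf
    rw [← VectorMeasure.integral_congr_ae hfg, hPf]
    refine Finset.sum_congr rfl fun r _ => ?_
    rw [integral_congr_ae (Measure.absolutelyContinuous_of_le (hle r) hfg)]

end JordanParts

/-! ### The system on the Fourier side -/

section FourierFunction

/-- The distribution `ψ` is the restriction of a tempered distribution, supported in the closed ball
of radius `R`, whose Fourier transform is the locally integrable function `F`. -/
def HasFourierFunction (R : ℝ) (ψ : PlaneDistribution) (F : Plane → ℂ) : Prop :=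
  LocallyIntegrable F volume ∧ ∃ T : 𝓢'(Plane, ℂ),
    (∀ f : 𝓓((⊤ : Opens Plane), ℝ), T (toSchwartz f) = ψ f) ∧
    IsVanishingOn T (Metric.closedBall 0 R)ᶜ ∧
    ∀ g : 𝓢(Plane, ℂ), Integrable (fun ζ => g ζ * F ζ) ∧ 𝓕 T g = ∫ ζ, g ζ * F ζ

variable {R : ℝ} {ψ ψ' : PlaneDistribution} {F F' : Plane → ℂ}

theorem HasFourierFunction.hasFourierTransform (h : HasFourierFunction R ψ F) :
    HasFourierTransform ψ F := by
  obtain ⟨hF, T, h1, _, h3⟩ := h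
  exact ⟨hF, T, h1, fun f => (h3 _).2⟩

theorem HasFourierFunction.sub (h : HasFourierFunction R ψ F) (h' : HasFourierFunction R ψ' F') :
    HasFourierFunction R (ψ - ψ') (fun ζ => F ζ - F' ζ) := by
  obtain ⟨hF, T, h1, h2, h3⟩ := h
  obtain ⟨hF', T', h1', h2', h3'⟩ := h'
  refine ⟨hF.sub hF', T - T', fun f => ?_, fun g hg => ?_, fun g => ?_⟩
  · change T _ - T' _ = ψ f - ψ' f
    rw [h1, h1']
  · change T _ - T' _ = 0
    rw [h2 g hg, h2' g hg, sub_zero]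
  · have e : ∀ ζ, g ζ * (F ζ - F' ζ) = g ζ * F ζ - g ζ * F' ζ := fun ζ => mul_sub _ _ _
    simp_rw [e]
    refine ⟨(h3 g).1.sub (h3' g).1, ?_⟩
    rw [integral_sub (h3 g).1 (h3' g).1, ← (h3 g).2, ← (h3' g).2]
    rfl

theorem HasFourierFunction.neg (h : HasFourierFunction R ψ F) :
    HasFourierFunction R (-ψ) (fun ζ => -F ζ) := by
  obtain ⟨hF, T, h1, h2, h3⟩ := h
  refine ⟨hF.neg, -T, fun f => ?_, fun g hg => ?_, fun g => ?_⟩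
  · change -T _ = -ψ f
    rw [h1]
  · change -T _ = 0
    rw [h2 g hg, neg_zero]
  · have e : ∀ ζ, g ζ * (-F ζ) = -(g ζ * F ζ) := fun ζ => mul_neg _ _
    simp_rw [e]
    refine ⟨(h3 g).1.neg, ?_⟩
    rw [integral_neg, ← (h3 g).2]
    rfl

theorem toSchwartz_neg_lineDeriv (m : Plane) (f : 𝓓((⊤ : Opens Plane), ℝ)) :
    toSchwartz (-∂_{m} f) = -∂_{m} (toSchwartz f) := by
  ext x
  change ((-(∂_{m} f x) : ℝ) : ℂ) = -(fderiv ℝ (fun x => (f x : ℂ)) x m)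
  have h1 : fderiv ℝ (fun x => (f x : ℂ)) x m = ((fderiv ℝ f x m : ℝ) : ℂ) := by
    have h2 : HasFDerivAt (fun x => (f x : ℂ)) (Complex.ofRealCLM.comp (fderiv ℝ f x)) x :=
      Complex.ofRealCLM.hasFDerivAt.comp x
        ((f.contDiff.differentiable (by norm_num)) x).hasFDerivAt
    rw [h2.fderiv]
    rfl
  have h3 : ∂_{m} f x = fderiv ℝ f x m := by
    change TestFunction.lineDerivCLM ℝ m f x = _
    rw [TestFunction.lineDerivCLM_apply, if_pos (by simp)]
    exact ((f.contDiff.differentiable (by norm_num)) x).lineDeriv_eq_fderiv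
  rw [h1, h3]
  push_cast
  rfl

theorem HasFourierFunction.lineDeriv (h : HasFourierFunction R ψ F) (m : Plane) :
    HasFourierFunction R (∂_{m} ψ) (fun ζ => (2 * Real.pi * Complex.I * (inner ℝ ζ m : ℝ)) * F ζ) := by
  obtain ⟨hF, T, h1, h2, h3⟩ := h
  have ht : (fun ζ : Plane => ((inner ℝ ζ m : ℝ) : ℂ)).HasTemperateGrowth := by fun_prop
  refine ⟨?_, ∂_{m} T, fun f => ?_, TemperedDistribution.IsVanishingOn.lineDerivOp h2 m, fun g => ?_⟩
  · have hc : Continuous fun ζ : Plane => 2 * Real.pi * Complex.I * ((inner ℝ ζ m : ℝ) : ℂ) := by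
      fun_prop
    exact hF.continuous_smul hc
  · rw [TemperedDistribution.lineDerivOp_apply_apply, Distribution.lineDerivOp_apply_apply, ← h1,
      toSchwartz_neg_lineDeriv]
  · have e : ∀ ζ, g ζ * ((2 * Real.pi * Complex.I * (inner ℝ ζ m : ℝ)) * F ζ) =
        (2 * Real.pi * Complex.I) *
          (SchwartzMap.smulLeftCLM ℂ (fun ζ : Plane => ((inner ℝ ζ m : ℝ) : ℂ)) g ζ * F ζ) := by
      intro ζ
      rw [SchwartzMap.smulLeftCLM_apply_apply ht, smul_eq_mul]
      ring
    simp_rw [e]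
    obtain ⟨h4, h5⟩ := h3 (SchwartzMap.smulLeftCLM ℂ (fun ζ : Plane => ((inner ℝ ζ m : ℝ) : ℂ)) g)
    refine ⟨h4.const_mul _, ?_⟩
    rw [integral_const_mul, ← h5, TemperedDistribution.fourier_lineDerivOp_eq]
    rfl

theorem HasFourierFunction.partial₁ (h : HasFourierFunction R ψ F) (k : ℕ) :
    HasFourierFunction R (partial₁ k ψ) (fun ζ => (2 * Real.pi * Complex.I * ζ 0) ^ k * F ζ) := by
  induction k with
  | zero => simpa [PlaneSobolev.partial₁] using h
  | succ k ih =>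
    have := ih.lineDeriv (EuclideanSpace.single 0 1)
    rw [PlaneSobolev.partial₁, Function.iterate_succ_apply']
    refine (congrArg (HasFourierFunction R _) (funext fun ζ => ?_)).mpr this
    have e : (inner ℝ ζ (EuclideanSpace.single 0 1) : ℝ) = ζ 0 := by
      simp [EuclideanSpace.inner_single_right]
    rw [e, pow_succ]
    ring

theorem HasFourierFunction.partial₂ (h : HasFourierFunction R ψ F) (l : ℕ) :
    HasFourierFunction R (partial₂ l ψ) (fun ζ => (2 * Real.pi * Complex.I * ζ 1) ^ l * F ζ) := by
  induction l with
  | zero => simpa [PlaneSobolev.partial₂] using h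
  | succ k ih =>
    have := ih.lineDeriv (EuclideanSpace.single 1 1)
    rw [PlaneSobolev.partial₂, Function.iterate_succ_apply']
    refine (congrArg (HasFourierFunction R _) (funext fun ζ => ?_)).mpr this
    have e : (inner ℝ ζ (EuclideanSpace.single 1 1) : ℝ) = ζ 1 := by
      simp [EuclideanSpace.inner_single_right]
    rw [e, pow_succ]
    ring

/-- The Fourier transform of a complex measure. -/
noncomputable def complexFourier (μ : ComplexMeasure Plane) (ζ : Plane) : ℂ :=
  ∑ r : Fin 4, Complex.I ^ (r : ℕ) * charFun (jordanPart μ r) (-(2 * Real.pi) • ζ)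

theorem continuous_complexFourier (μ : ComplexMeasure Plane) : Continuous (complexFourier μ) := by
  unfold complexFourier
  refine continuous_finsetSum _ fun r _ => continuous_const.mul ?_
  exact (continuous_charFun).comp (continuous_const_smul _)

/-- Fubini. The argument -2πζ converts the normalisation e^(i⟨t,x⟩) of `charFun` into the Fourier
kernel e^(-2πi⟨ζ,x⟩). -/
theorem integral_fourier_measure (ν : Measure Plane) [IsFiniteMeasure ν] (g : 𝓢(Plane, ℂ)) :
    ∫ x, 𝓕 g x ∂ν = ∫ ζ, g ζ * charFun ν (-(2 * Real.pi) • ζ) := by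
  have h := VectorFourier.integral_fourierIntegral_smul_eq_flip (μ := volume) (ν := ν)
    (L := innerₗ Plane) (f := g) (g := fun _ => (1 : ℂ)) Real.continuous_fourierChar
    continuous_inner g.integrable (integrable_const _)
  simp only [smul_eq_mul, mul_one] at h
  refine Eq.trans h (integral_congr_ae (Filter.Eventually.of_forall fun ζ => ?_))
  simp only [charFun_eq_fourierIntegral', smul_smul]
  congr 1
  have e : -(2 * Real.pi)⁻¹ * -(2 * Real.pi) = 1 := by field_simp
  rw [e, one_smul]
  rw [flip_innerₗ]
  rfl

theorem exists_hasFourierFunction {φ : PlaneDistribution} (hφ : dsupport φ ⊆ Metric.closedBall 0 R) :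
    ∃ F, HasFourierFunction R φ F := by
  let χ : ContDiffBump (0 : Plane) :=
    ⟨|R| + 1, |R| + 2, by positivity, by linarith⟩
  have hχ : ContDiff ℝ (⊤ : ℕ∞) χ := χ.contDiff
  have hχs : HasCompactSupport χ := χ.hasCompactSupport
  have hvan : IsVanishingOn φ (Metric.closedBall 0 R)ᶜ :=
    (isVanishingOn_compl_dsupport φ).mono (Set.compl_subset_compl.2 hφ)
  obtain ⟨n, C, hC, hbd⟩ := cutoffFunctional_bound hχ hχs φ
  obtain ⟨F, hF, hF'⟩ := exists_fourier_eq_integral (T := cutoffTempered hχ hχs φ) hC hbd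
  refine ⟨F, hF, cutoffTempered hχ hχs φ, fun f => ?_, isVanishingOn_cutoffTempered hχ hχs hvan, hF'⟩
  refine cutoffTempered_toSchwartz hχ hχs hvan (fun x hx => ?_) f
  exact χ.eventuallyEq_one_of_mem_ball (Metric.closedBall_subset_ball
    (lt_of_le_of_lt (le_abs_self R) (lt_add_one _)) (not_not.1 hx))

/-- Since T and μ both live on the ball, their agreement on test functions extends to all Schwartz
functions. It can then be applied to the transform of a test function, which is not compactly
supported in general, and F is identified by testing. -/
theorem HasFourierFunction.ae_eq_complexFourier {μ : ComplexMeasure Plane}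
    (h : HasFourierFunction R ψ F) (hψ : EqMeasure ψ μ)
    (hμ : μ.variation (Metric.closedBall 0 R)ᶜ = 0) : F =ᵐ[volume] complexFourier μ := by
  obtain ⟨hF, T, hT, hvan, hTF⟩ := h
  let χ : ContDiffBump (0 : Plane) :=
    ⟨|R| + 1, |R| + 2, by positivity, by linarith⟩
  have hχ : ContDiff ℝ (⊤ : ℕ∞) χ := χ.contDiff
  have hχs : HasCompactSupport χ := χ.hasCompactSupport
  have hχ1 : ∀ x ∈ Metric.closedBall (0 : Plane) R, ∀ᶠ y in nhds x, χ y = 1 :=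
    fun x hx => χ.eventuallyEq_one_of_mem_ball (Metric.closedBall_subset_ball
      (lt_of_le_of_lt (le_abs_self R) (lt_add_one _)) hx)
  have hν : ∀ r, ∀ᵐ x ∂(jordanPart μ r), x ∈ Metric.closedBall (0 : Plane) R := fun r =>
    Measure.absolutelyContinuous_of_le (jordanPart_le_variation μ r) hμ
  have key : ∀ h : 𝓢(Plane, ℂ), T h = ∑ r : Fin 4, Complex.I ^ (r : ℕ) * ∫ x, h x ∂(jordanPart μ r) := by
    intro h
    set u := cutoffTest χ hχ hχs _ (contDiff_re h)
    set v := cutoffTest χ hχ hχs _ (contDiff_im h)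
    -- The difference is (1 - χ)h, which vanishes near every point of the ball and so is invisible
    -- to T.
    have h1 : T (h - (toSchwartz u + Complex.I • toSchwartz v)) = 0 := by
      refine hvan _ fun x hx hxR => ?_
      refine notMem_tsupport_iff_eventuallyEq.2 ?_ hx
      filter_upwards [hχ1 x hxR] with y hy
      change h y - (((χ y * (h y).re : ℝ) : ℂ) + Complex.I * ((χ y * (h y).im : ℝ) : ℂ)) = 0
      rw [hy, one_mul, one_mul, mul_comm Complex.I, Complex.re_add_im, sub_self]
    have hint : ∀ w : 𝓓((⊤ : Opens Plane), ℝ), Integrable (fun x => w x) μ.variation := fun w =>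
      w.contDiff.continuous.integrable_of_hasCompactSupport w.hasCompactSupport
    rw [map_sub, map_add, map_smul, hT, hT, hψ, hψ, sub_eq_zero, integral_eq_sum_jordanPart μ (hint u),
      integral_eq_sum_jordanPart μ (hint v), Finset.smul_sum, ← Finset.sum_add_distrib] at h1
    rw [h1]
    refine Finset.sum_congr rfl fun r _ => ?_
    have h2 : ∫ x, h x ∂(jordanPart μ r) = ∫ x, ((u x : ℂ) + (v x : ℂ) * Complex.I) ∂(jordanPart μ r) := by
      refine integral_congr_ae ?_
      filter_upwards [hν r] with x hx
      change h x = ((χ x * (h x).re : ℝ) : ℂ) + ((χ x * (h x).im : ℝ) : ℂ) * Complex.I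
      rw [(hχ1 x hx).self_of_nhds, one_mul, one_mul, Complex.re_add_im]
    have hint' : ∀ w : 𝓓((⊤ : Opens Plane), ℝ), Integrable (fun x => (w x : ℂ)) (jordanPart μ r) :=
      fun w => ((hint w).mono_measure (jordanPart_le_variation μ r)).ofReal
    rw [h2, integral_add (hint' u) ((hint' v).mul_const _), integral_mul_const, integral_complex_ofReal,
      integral_complex_ofReal, smul_eq_mul]
    ring
  refine ae_eq_of_integral_contDiff_smul_eq hF (continuous_complexFourier μ).locallyIntegrable
    fun g hg hgs => ?_
  let G : 𝓢(Plane, ℂ) := HasCompactSupport.toSchwartzMap (f := fun x => (g x : ℂ))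
    (hgs.comp_left (g := Complex.ofReal) Complex.ofReal_zero) (Complex.ofRealCLM.contDiff.comp hg)
  have hG : ∀ x, G x = g x := fun x => rfl
  have h3 : 𝓕 T G = T (𝓕 G) := rfl
  rw [(hTF G).2, key] at h3
  simp_rw [integral_fourier_measure, ← integral_const_mul] at h3
  rw [← integral_finsetSum] at h3
  · simp only [hG] at h3
    refine Eq.trans ?_ (h3.trans ?_)
    · simp
    · refine integral_congr_ae (Filter.Eventually.of_forall fun ζ => ?_)
      simp only [complexFourier, Complex.real_smul, Finset.mul_sum]
      refine Finset.sum_congr rfl fun r _ => ?_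
      ring
  · intro r _
    refine Integrable.const_mul ?_ _
    refine Continuous.integrable_of_hasCompactSupport ?_ ?_
    · exact G.continuous.mul (continuous_charFun.comp (continuous_const_smul _))
    · exact (hgs.comp_left (g := Complex.ofReal) Complex.ofReal_zero).mul_right

/-- The Fourier transforms of the distributions in the system are functions, and they satisfy the
corresponding algebraic equations almost everywhere. -/
theorem exists_fourier_system {k l N : ℕ} (hN : 1 ≤ N) {φ : ℕ → PlaneDistribution}
    {μ : ℕ → ComplexMeasure Plane} (hφ : ∀ j ∈ Finset.Icc 1 N, HasCompactDSupport (φ j))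
    (hμ : ∀ j ∈ Finset.Icc 0 N, IsCompactlySupportedMeasure (μ j))
    (h0 : EqMeasure (-PlaneSobolev.partial₁ k (φ 1)) (μ 0))
    (hj : ∀ j ∈ Finset.Icc 1 (N - 1),
      EqMeasure (PlaneSobolev.partial₂ l (φ j) - PlaneSobolev.partial₁ k (φ (j + 1))) (μ j))
    (hl : EqMeasure (PlaneSobolev.partial₂ l (φ N)) (μ N)) :
    ∃ F : ℕ → Plane → ℂ, (∀ j ∈ Finset.Icc 1 N, HasFourierTransform (φ j) (F j)) ∧
      ∀ᵐ ζ : Plane, -((2 * Real.pi * Complex.I * ζ 0) ^ k * F 1 ζ) = complexFourier (μ 0) ζ ∧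
        (∀ j ∈ Finset.Icc 1 (N - 1), (2 * Real.pi * Complex.I * ζ 1) ^ l * F j ζ -
          (2 * Real.pi * Complex.I * ζ 0) ^ k * F (j + 1) ζ = complexFourier (μ j) ζ) ∧
        (2 * Real.pi * Complex.I * ζ 1) ^ l * F N ζ = complexFourier (μ N) ζ := by
  have hμ' : ∀ j, ∃ K : Set Plane, IsCompact K ∧ (j ∈ Finset.Icc 0 N → (μ j).variation Kᶜ = 0) := by
    intro j
    by_cases h : j ∈ Finset.Icc 0 N
    · obtain ⟨K, hK, h1⟩ := hμ j h
      exact ⟨K, hK, fun _ => h1⟩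
    · exact ⟨∅, isCompact_empty, fun h' => absurd h' h⟩
  choose K hK hμK using hμ'
  have hcomp : IsCompact ((⋃ j ∈ Finset.Icc 1 N, dsupport (φ j)) ∪ ⋃ j ∈ Finset.Icc 0 N, K j) :=
    ((Finset.Icc 1 N).isCompact_biUnion fun j hj => hφ j hj).union
      ((Finset.Icc 0 N).isCompact_biUnion fun j _ => hK j)
  obtain ⟨R, hR⟩ := hcomp.isBounded.subset_closedBall 0
  have hφR : ∀ j ∈ Finset.Icc 1 N, ∃ F, HasFourierFunction R (φ j) F := fun j hj =>
    exists_hasFourierFunction (((Set.subset_biUnion_of_mem (u := fun j => dsupport (φ j)) hj).trans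
      Set.subset_union_left).trans hR)
  have hμR : ∀ j ∈ Finset.Icc 0 N, (μ j).variation (Metric.closedBall 0 R)ᶜ = 0 := fun j hj =>
    measure_mono_null (Set.compl_subset_compl.2 (((Set.subset_biUnion_of_mem (u := K) hj).trans
      Set.subset_union_right).trans hR)) (hμK j hj)
  choose! F hF using hφR
  refine ⟨F, fun j hj => (hF j hj).hasFourierTransform, ?_⟩
  have e0 := ((hF 1 (Finset.mem_Icc.2 ⟨le_rfl, hN⟩)).partial₁ k).neg.ae_eq_complexFourier h0
    (hμR 0 (by simp))
  have eN := ((hF N (Finset.mem_Icc.2 ⟨hN, le_rfl⟩)).partial₂ l).ae_eq_complexFourier hl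
    (hμR N (by simp))
  have ej : ∀ᵐ ζ : Plane, ∀ j ∈ Finset.Icc 1 (N - 1), (2 * Real.pi * Complex.I * ζ 1) ^ l * F j ζ -
      (2 * Real.pi * Complex.I * ζ 0) ^ k * F (j + 1) ζ = complexFourier (μ j) ζ := by
    refine (Filter.eventually_all_finset _).2 fun j hj' => ?_
    obtain ⟨h1, h2⟩ := Finset.mem_Icc.1 hj'
    exact (((hF j (Finset.mem_Icc.2 ⟨h1, by omega⟩)).partial₂ l).sub
      ((hF (j + 1) (Finset.mem_Icc.2 ⟨by omega, by omega⟩)).partial₁ k)).ae_eq_complexFourier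
      (hj j hj') (hμR j (Finset.mem_Icc.2 ⟨by omega, by omega⟩))
  filter_upwards [e0, ej, eN] with ζ h1 h2 h3 using ⟨h1, h2, h3⟩

end FourierFunction

/-! ### One-dimensional transforms of weighted Gaussians -/

section OscillatoryIntegrals

/-- The character `t ↦ exp (-2πit)`. -/
noncomputable def osc (t : ℝ) : ℂ := Complex.exp (Complex.I * ((-(2 * Real.pi * t) : ℝ) : ℂ))

theorem norm_osc (t : ℝ) : ‖osc t‖ = 1 := Complex.norm_exp_I_mul_ofReal _

theorem osc_zero : osc 0 = 1 := by simp [osc]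

theorem osc_add (s t : ℝ) : osc (s + t) = osc s * osc t := by
  rw [osc, osc, osc, ← Complex.exp_add]
  congr 1
  push_cast
  ring

@[fun_prop]
theorem continuous_osc : Continuous osc := by
  unfold osc
  fun_prop

theorem norm_osc_sub_one_le (t : ℝ) : ‖osc t - 1‖ ≤ 2 * Real.pi * |t| := by
  refine (Real.norm_exp_I_mul_ofReal_sub_one_le).trans (le_of_eq ?_)
  rw [norm_neg, Real.norm_eq_abs, abs_mul, abs_of_pos (by positivity : (0 : ℝ) < 2 * Real.pi)]

theorem hasDerivAt_osc (z x : ℝ) :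
    HasDerivAt (fun x => osc (x * z)) (-(2 * Real.pi * z) * Complex.I * osc (x * z)) x := by
  have h1 : HasDerivAt (fun x : ℝ => Complex.I * ((-(2 * Real.pi * (x * z)) : ℝ) : ℂ))
      (Complex.I * ((-(2 * Real.pi * z) : ℝ) : ℂ)) x := by
    refine HasDerivAt.const_mul _ (HasDerivAt.ofReal_comp ?_)
    have h0 : (fun x : ℝ => -(2 * Real.pi * (x * z))) = fun x => x * -(2 * Real.pi * z) := by
      funext x
      ring
    rw [h0]
    simpa using (hasDerivAt_id x).mul_const (-(2 * Real.pi * z))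
  refine h1.cexp.congr_deriv ?_
  rw [osc]
  push_cast
  ring

/-- The one-dimensional Fourier transform of a real function. -/
noncomputable def fourierLine (h : ℝ → ℝ) (z : ℝ) : ℂ := ∫ x, (h x : ℂ) * osc (x * z)

/-- The Gaussian `|x| ^ p * x ^ n * exp (-c x²)` with polynomial weight. -/
noncomputable def weightedGaussian (p n : ℕ) (c : ℝ) (x : ℝ) : ℝ :=
  |x| ^ p * x ^ n * Real.exp (-c * x ^ 2)

theorem continuous_weightedGaussian (p n : ℕ) (c : ℝ) : Continuous (weightedGaussian p n c) := by
  unfold weightedGaussian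
  fun_prop

theorem integrable_pow_mul_gaussian (m : ℕ) {c : ℝ} (hc : 0 < c) :
    Integrable fun x : ℝ => x ^ m * Real.exp (-c * x ^ 2) := by
  have h := integrable_rpow_mul_exp_neg_mul_sq hc (s := (m : ℝ))
    (lt_of_lt_of_le (by norm_num) (Nat.cast_nonneg m))
  simpa only [Real.rpow_natCast] using h

theorem integrable_weightedGaussian (p n : ℕ) {c : ℝ} (hc : 0 < c) :
    Integrable (weightedGaussian p n c) := by
  refine (integrable_pow_mul_gaussian (p + n) hc).mono
    (continuous_weightedGaussian p n c).aestronglyMeasurable (Filter.Eventually.of_forall fun x => ?_)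
  rw [weightedGaussian, norm_mul, norm_mul, norm_mul, norm_pow, norm_pow, norm_pow, pow_add]
  simp

theorem integrable_mul_osc {h : ℝ → ℝ} {s : Set ℝ} (hh : IntegrableOn h s) (z : ℝ) :
    IntegrableOn (fun x => (h x : ℂ) * osc (x * z)) s := by
  refine Integrable.mul_bdd (c := 1) hh.ofReal
    (by fun_prop : Continuous fun x => osc (x * z)).aestronglyMeasurable
    (Filter.Eventually.of_forall fun x => (norm_osc _).le)

theorem integrable_weightedGaussian_mul_osc (p n : ℕ) {c : ℝ} (hc : 0 < c) (z : ℝ) :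
    Integrable fun x => (weightedGaussian p n c x : ℂ) * osc (x * z) := by
  rw [← integrableOn_univ]
  exact integrable_mul_osc (integrable_weightedGaussian p n hc).integrableOn z

theorem norm_fourierLine_weightedGaussian_le (p n : ℕ) (c : ℝ) (z : ℝ) :
    ‖fourierLine (weightedGaussian p n c) z‖ ≤ ∫ x, |weightedGaussian p n c x| := by
  refine (norm_integral_le_integral_norm _).trans (le_of_eq ?_)
  simp [norm_osc]

/-- From |e^(-2πixz) - 1| ≤ 2π|x||z|; the factor |x| raises the moment by one. -/
theorem norm_fourierLine_weightedGaussian_sub_le (p n : ℕ) {c : ℝ} (hc : 0 < c) (z : ℝ) :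
    ‖fourierLine (weightedGaussian p n c) z - fourierLine (weightedGaussian p n c) 0‖ ≤
      (2 * Real.pi * ∫ x, |weightedGaussian p (n + 1) c x|) * |z| := by
  rw [fourierLine, fourierLine, ← integral_sub (integrable_weightedGaussian_mul_osc p n hc z)
    (integrable_weightedGaussian_mul_osc p n hc 0), ← integral_const_mul, ← integral_mul_const]
  refine norm_integral_le_of_norm_le
    (((integrable_weightedGaussian p (n + 1) hc).abs.const_mul _).mul_const _)
    (Filter.Eventually.of_forall fun x => ?_)
  rw [mul_zero, osc_zero, ← mul_sub, norm_mul, Complex.norm_real, Real.norm_eq_abs]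
  refine (mul_le_mul_of_nonneg_left (norm_osc_sub_one_le _) (abs_nonneg _)).trans (le_of_eq ?_)
  have : weightedGaussian p (n + 1) c x = weightedGaussian p n c x * x := by
    rw [weightedGaussian, weightedGaussian]
    ring
  rw [this, abs_mul, abs_mul]
  ring

/-- Integration by parts on a half-line. -/
theorem exists_halfLine_decay (m : ℕ) {c : ℝ} (hc : 0 < c) :
    ∃ C, ∀ z : ℝ, |z| * ‖∫ x in Set.Ioi (0 : ℝ),
      ((x ^ m * Real.exp (-c * x ^ 2) : ℝ) : ℂ) * osc (x * z)‖ ≤ C := by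
  set u : ℝ → ℝ := fun x => x ^ m * Real.exp (-c * x ^ 2) with hu
  set v : ℝ → ℝ := fun x => m * (x ^ (m - 1) * Real.exp (-c * x ^ 2)) -
    2 * c * (x ^ (m + 1) * Real.exp (-c * x ^ 2)) with hv
  have hderiv : ∀ x, HasDerivAt u (v x) x := by
    intro x
    have h1 : HasDerivAt (fun x : ℝ => -c * x ^ 2) (-c * (2 * x)) x := by
      simpa using (hasDerivAt_pow 2 x).const_mul (-c)
    refine ((hasDerivAt_pow m x).mul h1.exp).congr_deriv ?_
    simp only [hv]
    ring
  have hui : Integrable u := integrable_pow_mul_gaussian m hc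
  have hvi : Integrable v :=
    ((integrable_pow_mul_gaussian (m - 1) hc).const_mul _).sub
      ((integrable_pow_mul_gaussian (m + 1) hc).const_mul _)
  refine ⟨|u 0| + ∫ x, |v x|, fun z => ?_⟩
  have hu' := integrable_mul_osc hui.integrableOn z (s := Set.Ioi 0)
  have hv' := integrable_mul_osc hvi.integrableOn z (s := Set.Ioi 0)
  have hd : ∀ x, HasDerivAt (fun x => (u x : ℂ) * osc (x * z))
      ((v x : ℂ) * osc (x * z) + (-(2 * Real.pi * z) * Complex.I) * ((u x : ℂ) * osc (x * z))) x := by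
    intro x
    refine ((hderiv x).ofReal_comp.mul (hasDerivAt_osc z x)).congr_deriv ?_
    ring
  have hlim : Filter.Tendsto (fun x => (u x : ℂ) * osc (x * z)) Filter.atTop (nhds 0) :=
    tendsto_zero_of_hasDerivAt_of_integrableOn_Ioi (a := 0) (fun x _ => hd x)
      (hv'.add (hu'.const_mul _)) hu'
  have h1 := integral_Ioi_of_hasDerivAt_of_tendsto (a := 0) (hd 0).continuousAt.continuousWithinAt
    (fun x _ => hd x) (hv'.add (hu'.const_mul _)) hlim
  rw [integral_add hv' (hu'.const_mul _), integral_const_mul] at h1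
  set J := ∫ x in Set.Ioi (0 : ℝ), (u x : ℂ) * osc (x * z) with hJ
  have h2 : (-(2 * Real.pi * z) * Complex.I) * J =
      -((u 0 : ℂ) * osc (0 * z)) - ∫ x in Set.Ioi (0 : ℝ), (v x : ℂ) * osc (x * z) := by
    linear_combination h1
  have h3 : 2 * Real.pi * (|z| * ‖J‖) ≤ |u 0| + ∫ x, |v x| := by
    have h4 := congrArg norm h2
    rw [norm_mul, norm_mul, norm_neg, Complex.norm_I, mul_one, norm_mul, norm_mul, Complex.norm_real,
      Complex.norm_real, Complex.norm_ofNat, Real.norm_eq_abs, abs_of_pos Real.pi_pos] at h4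
    rw [← mul_assoc, ← Real.norm_eq_abs z, h4]
    refine (norm_sub_le _ _).trans (add_le_add ?_ ?_)
    · rw [norm_neg, norm_mul, norm_osc, mul_one, Complex.norm_real, Real.norm_eq_abs]
    · refine (norm_integral_le_integral_norm _).trans ?_
      have e : ∀ x, ‖(v x : ℂ) * osc (x * z)‖ = |v x| := by simp [norm_osc]
      simp_rw [e]
      exact setIntegral_le_integral hvi.abs (Filter.Eventually.of_forall fun x => abs_nonneg _)
  refine le_trans ?_ h3
  have h5 : 0 ≤ |z| * ‖J‖ := by positivity
  nlinarith [Real.pi_gt_three]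

/-- The weight |x|^p need not be smooth at 0, so the half-lines are treated separately; reflection
turns the left one into the right one at frequency -z, up to sign. First-order decay is enough for
the dyadic sums. -/
theorem exists_fourierLine_weightedGaussian_decay (p n : ℕ) {c : ℝ} (hc : 0 < c) :
    ∃ C, ∀ z, |z| * ‖fourierLine (weightedGaussian p n c) z‖ ≤ C := by
  obtain ⟨C, hC⟩ := exists_halfLine_decay (p + n) hc
  refine ⟨C + C, fun z => ?_⟩
  have hi := integrable_weightedGaussian_mul_osc p n hc z
  have h1 : ∫ x in Set.Ioi (0 : ℝ), (weightedGaussian p n c x : ℂ) * osc (x * z) =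
      ∫ x in Set.Ioi (0 : ℝ), ((x ^ (p + n) * Real.exp (-c * x ^ 2) : ℝ) : ℂ) * osc (x * z) := by
    refine setIntegral_congr_fun measurableSet_Ioi fun x hx => ?_
    simp only [weightedGaussian]
    rw [abs_of_pos hx, pow_add]
  have h2 : ∫ x in Set.Iic (0 : ℝ), (weightedGaussian p n c x : ℂ) * osc (x * z) =
      (-1) ^ n * ∫ x in Set.Ioi (0 : ℝ),
        ((x ^ (p + n) * Real.exp (-c * x ^ 2) : ℝ) : ℂ) * osc (x * -z) := by
    have h3 := integral_comp_neg_Ioi (0 : ℝ) fun x => (weightedGaussian p n c x : ℂ) * osc (x * z)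
    rw [neg_zero] at h3
    rw [← h3, ← integral_const_mul]
    refine setIntegral_congr_fun measurableSet_Ioi fun x hx => ?_
    simp only [weightedGaussian]
    rw [abs_neg, abs_of_pos hx, neg_sq, neg_pow x n, neg_mul_comm, pow_add]
    push_cast
    ring_nf
  rw [fourierLine, ← intervalIntegral.integral_Iic_add_Ioi hi.integrableOn hi.integrableOn, h1, h2]
  have h4 := hC (-z)
  rw [abs_neg] at h4
  calc _ ≤ |z| * (‖∫ x in Set.Ioi (0 : ℝ),
        ((x ^ (p + n) * Real.exp (-c * x ^ 2) : ℝ) : ℂ) * osc (x * -z)‖ + ‖∫ x in Set.Ioi (0 : ℝ),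
        ((x ^ (p + n) * Real.exp (-c * x ^ 2) : ℝ) : ℂ) * osc (x * z)‖) := by
        refine mul_le_mul_of_nonneg_left ((norm_add_le _ _).trans ?_) (abs_nonneg z)
        rw [norm_mul, norm_pow, norm_neg, norm_one, one_pow, one_mul]
    _ ≤ C + C := by
        rw [mul_add]
        exact add_le_add h4 (hC z)

end OscillatoryIntegrals

/-! ### Gaussian kernels in the plane and their dilations -/

section Kernels

theorem integral_weightedGaussian_odd (p : ℕ) {n : ℕ} (hn : Odd n) (c : ℝ) :
    ∫ x, weightedGaussian p n c x = 0 := by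
  have h := integral_neg_eq_self (weightedGaussian p n c) volume
  have e : ∀ x, weightedGaussian p n c (-x) = -weightedGaussian p n c x := by
    intro x
    rw [weightedGaussian, weightedGaussian, abs_neg, hn.neg_pow, neg_sq]
    ring
  simp_rw [e, integral_neg] at h
  linarith

theorem integral_weightedGaussian_pos (p : ℕ) {n : ℕ} (hn : Even n) {c : ℝ} (hc : 0 < c) :
    0 < ∫ x, weightedGaussian p n c x := by
  have hnn : ∀ x, 0 ≤ weightedGaussian p n c x := fun x => by
    have := hn.pow_nonneg x
    unfold weightedGaussian
    positivity
  refine (integral_pos_iff_support_of_nonneg hnn (integrable_weightedGaussian p n hc)).2 ?_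
  have hsub : Set.Ioo (0 : ℝ) 1 ⊆ Function.support (weightedGaussian p n c) := by
    intro x hx
    have hx0 : 0 < x := hx.1
    have : 0 < weightedGaussian p n c x := by
      unfold weightedGaussian
      positivity
    exact this.ne'
  refine lt_of_lt_of_le ?_ (measure_mono hsub)
  simp

theorem integral_weightedGaussian_scale (p n : ℕ) {s : ℝ} (hs : 0 < s) :
    ∫ x, weightedGaussian p n (s ^ 2) x =
      (s ^ (p + n + 1))⁻¹ * ∫ x, weightedGaussian p n 1 x := by
  have h := Measure.integral_comp_mul_left (weightedGaussian p n 1) s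
  have e : ∀ x, weightedGaussian p n 1 (s * x) = s ^ (p + n) * weightedGaussian p n (s ^ 2) x := by
    intro x
    have e1 : -1 * (s * x) ^ 2 = -s ^ 2 * x ^ 2 := by ring
    rw [weightedGaussian, weightedGaussian, abs_mul, abs_of_pos hs, mul_pow, mul_pow, e1]
    ring
  simp_rw [e, integral_const_mul] at h
  rw [abs_of_pos (inv_pos.2 hs), smul_eq_mul] at h
  have h2 : s ^ (p + n) ≠ 0 := by positivity
  rw [pow_succ s (p + n), mul_inv, mul_assoc, ← h, ← mul_assoc, inv_mul_cancel₀ h2, one_mul]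

theorem fourierLine_zero (h : ℝ → ℝ) : fourierLine h 0 = ((∫ x, h x : ℝ) : ℂ) := by
  simp [fourierLine, osc_zero, integral_complex_ofReal]

theorem continuous_fourierLine {h : ℝ → ℝ} (hh : Integrable h) : Continuous (fourierLine h) := by
  refine continuous_of_dominated (bound := fun x => |h x|) (fun z => ?_) (fun z => ?_) hh.abs ?_
  · exact hh.ofReal.aestronglyMeasurable.mul
      (by fun_prop : Continuous fun x => osc (x * z)).aestronglyMeasurable
  · exact Filter.Eventually.of_forall fun x => by simp [norm_osc]
  · exact Filter.Eventually.of_forall fun x => by fun_prop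

theorem fourierLine_scale (h : ℝ → ℝ) {s : ℝ} (hs : 0 < s) (z : ℝ) :
    s * ∫ x, (h (s * x) : ℂ) * osc (x * z) = fourierLine h (z / s) := by
  have h1 := Measure.integral_comp_mul_left (fun x => (h x : ℂ) * osc (x * (z / s))) s
  rw [abs_of_pos (inv_pos.2 hs)] at h1
  have e : ∀ x, s * x * (z / s) = x * z := fun x => by field_simp
  simp_rw [e] at h1
  rw [h1, fourierLine, Complex.real_smul, ← mul_assoc]
  push_cast
  rw [mul_inv_cancel₀ (by exact_mod_cast hs.ne'), one_mul]

theorem measurePreserving_coords :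
    MeasurePreserving (fun ζ : Plane => (ζ 0, ζ 1)) volume volume :=
  (volume_preserving_finTwoArrow ℝ).comp (PiLp.volume_preserving_ofLp (Fin 2))

theorem measurableEmbedding_coords : MeasurableEmbedding fun ζ : Plane => (ζ 0, ζ 1) :=
  (MeasurableEquiv.finTwoArrow (α := ℝ)).measurableEmbedding.comp
    (MeasurableEquiv.toLp 2 (Fin 2 → ℝ)).symm.measurableEmbedding

theorem integral_coords (f : ℝ → ℝ → ℂ) :
    ∫ ζ : Plane, f (ζ 0) (ζ 1) = ∫ p : ℝ × ℝ, f p.1 p.2 :=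
  measurePreserving_coords.integral_comp measurableEmbedding_coords fun p => f p.1 p.2

/-- `K` is an integrable function of two variables that has the Fourier transform `Q`, also after
anisotropic dilations, and `Q` has first-order decay and regularity. -/
structure IsDilationKernel (K : ℝ → ℝ → ℝ) (Q : ℝ → ℝ → ℂ) : Prop where
  integrable : ∀ s t : ℝ, 0 < s → 0 < t → Integrable fun ζ : Plane => K (s * ζ 0) (t * ζ 1)
  continuous : Continuous fun p : ℝ × ℝ => Q p.1 p.2
  fourier : ∀ s t : ℝ, 0 < s → 0 < t → ∀ x : Plane,
    s * t * ∫ ζ : Plane, (K (s * ζ 0) (t * ζ 1) : ℂ) * osc (ζ 0 * x 0 + ζ 1 * x 1) =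
      Q (x 0 / s) (x 1 / t)
  decay : ∃ C, ∀ z w, (|z| + |w|) * ‖Q z w‖ ≤ C
  regular : ∃ C, ∀ z w, ‖Q z w - Q 0 0‖ ≤ C * (|z| + |w|)

theorem integrable_coords_mul {f g : ℝ → ℝ} (hf : Integrable f) (hg : Integrable g) :
    Integrable fun ζ : Plane => f (ζ 0) * g (ζ 1) :=
  (measurePreserving_coords.integrable_comp_emb measurableEmbedding_coords
    (g := fun p : ℝ × ℝ => f p.1 * g p.2)).2 (hf.mul_prod hg)

/-- Everything factors. Decay in (z, w) comes from decay of one factor times boundedness of the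
other, and regularity from the product rule for differences. -/
theorem isDilationKernel_weightedGaussian (p n p' n' : ℕ) {c c' : ℝ} (hc : 0 < c) (hc' : 0 < c') :
    IsDilationKernel (fun x y => weightedGaussian p n c x * weightedGaussian p' n' c' y)
      (fun z w => fourierLine (weightedGaussian p n c) z *
        fourierLine (weightedGaussian p' n' c') w) := by
  have hi := integrable_weightedGaussian p n hc
  have hi' := integrable_weightedGaussian p' n' hc'
  set h := weightedGaussian p n c
  set h' := weightedGaussian p' n' c'
  obtain ⟨A, hA⟩ : ∃ A, ∀ z, ‖fourierLine h z‖ ≤ A :=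
    ⟨_, norm_fourierLine_weightedGaussian_le p n c⟩
  obtain ⟨A', hA'⟩ : ∃ A, ∀ z, ‖fourierLine h' z‖ ≤ A :=
    ⟨_, norm_fourierLine_weightedGaussian_le p' n' c'⟩
  obtain ⟨B, hB⟩ : ∃ B, ∀ z, |z| * ‖fourierLine h z‖ ≤ B :=
    exists_fourierLine_weightedGaussian_decay p n hc
  obtain ⟨B', hB'⟩ : ∃ B, ∀ z, |z| * ‖fourierLine h' z‖ ≤ B :=
    exists_fourierLine_weightedGaussian_decay p' n' hc'
  obtain ⟨D, hD⟩ : ∃ D, ∀ z, ‖fourierLine h z - fourierLine h 0‖ ≤ D * |z| :=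
    ⟨_, norm_fourierLine_weightedGaussian_sub_le p n hc⟩
  obtain ⟨D', hD'⟩ : ∃ D, ∀ z, ‖fourierLine h' z - fourierLine h' 0‖ ≤ D * |z| :=
    ⟨_, norm_fourierLine_weightedGaussian_sub_le p' n' hc'⟩
  have hA0 : 0 ≤ A := (norm_nonneg _).trans (hA 0)
  have hA0' : 0 ≤ A' := (norm_nonneg _).trans (hA' 0)
  refine ⟨fun s t hs ht => ?_, ?_, fun s t hs ht x => ?_, ⟨B * A' + B' * A, fun z w => ?_⟩,
    ⟨|D| * A' + |D'| * A, fun z w => ?_⟩⟩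
  · exact integrable_coords_mul (hi.comp_mul_left' hs.ne') (hi'.comp_mul_left' ht.ne')
  · exact ((continuous_fourierLine hi).comp continuous_fst).mul
      ((continuous_fourierLine hi').comp continuous_snd)
  · rw [← fourierLine_scale h hs, ← fourierLine_scale h' ht,
      integral_coords fun a b => ((h (s * a) * h' (t * b) : ℝ) : ℂ) * osc (a * x 0 + b * x 1)]
    have e : ∀ q : ℝ × ℝ, ((h (s * q.1) * h' (t * q.2) : ℝ) : ℂ) * osc (q.1 * x 0 + q.2 * x 1) =
        ((h (s * q.1) : ℂ) * osc (q.1 * x 0)) * ((h' (t * q.2) : ℂ) * osc (q.2 * x 1)) := by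
      intro q
      rw [osc_add]
      push_cast
      ring
    simp_rw [e]
    rw [Measure.volume_eq_prod, integral_prod_mul (fun a => (h (s * a) : ℂ) * osc (a * x 0))
      (fun b => (h' (t * b) : ℂ) * osc (b * x 1))]
    ring
  · rw [norm_mul]
    have h1 := mul_le_mul (hB z) (hA' w) (norm_nonneg _) ((mul_nonneg (abs_nonneg _)
      (norm_nonneg _)).trans (hB z))
    have h2 := mul_le_mul (hB' w) (hA z) (norm_nonneg _) ((mul_nonneg (abs_nonneg _)
      (norm_nonneg _)).trans (hB' w))
    linarith
  · have e : fourierLine h z * fourierLine h' w - fourierLine h 0 * fourierLine h' 0 =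
        (fourierLine h z - fourierLine h 0) * fourierLine h' w +
          fourierLine h 0 * (fourierLine h' w - fourierLine h' 0) := by ring
    rw [e]
    refine (norm_add_le _ _).trans ?_
    rw [norm_mul, norm_mul]
    have h1 : ‖fourierLine h z - fourierLine h 0‖ * ‖fourierLine h' w‖ ≤ |D| * |z| * A' := by
      refine mul_le_mul ((hD z).trans ?_) (hA' w) (norm_nonneg _) (by positivity)
      exact mul_le_mul_of_nonneg_right (le_abs_self D) (abs_nonneg z)
    have h2 : ‖fourierLine h 0‖ * ‖fourierLine h' w - fourierLine h' 0‖ ≤ A * (|D'| * |w|) := by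
      refine mul_le_mul (hA 0) ((hD' w).trans ?_) (norm_nonneg _) hA0
      exact mul_le_mul_of_nonneg_right (le_abs_self D') (abs_nonneg w)
    have h3 : 0 ≤ |D| * A' * |w| := by positivity
    have h4 : 0 ≤ |D'| * A * |z| := by positivity
    linarith

theorem IsDilationKernel.add {K K' : ℝ → ℝ → ℝ} {Q Q' : ℝ → ℝ → ℂ} (h : IsDilationKernel K Q)
    (h' : IsDilationKernel K' Q') :
    IsDilationKernel (fun x y => K x y + K' x y) (fun z w => Q z w + Q' z w) := by
  obtain ⟨C, hC⟩ := h.decay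
  obtain ⟨C', hC'⟩ := h'.decay
  obtain ⟨D, hD⟩ := h.regular
  obtain ⟨D', hD'⟩ := h'.regular
  refine ⟨fun s t hs ht => (h.integrable s t hs ht).add (h'.integrable s t hs ht),
    h.continuous.add h'.continuous, fun s t hs ht x => ?_, ⟨C + C', fun z w => ?_⟩,
    ⟨D + D', fun z w => ?_⟩⟩
  · rw [← h.fourier s t hs ht, ← h'.fourier s t hs ht, ← mul_add, ← integral_add]
    · congr 1
      refine integral_congr_ae (Filter.Eventually.of_forall fun ζ => ?_)
      simp only
      push_cast
      ring
    all_goals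
      refine Integrable.mul_bdd (c := 1) (Integrable.ofReal ?_) ?_
        (Filter.Eventually.of_forall fun x => (norm_osc _).le)
    · exact h.integrable s t hs ht
    · exact (by fun_prop : Continuous fun ζ : Plane =>
        osc (ζ 0 * x 0 + ζ 1 * x 1)).aestronglyMeasurable
    · exact h'.integrable s t hs ht
    · exact (by fun_prop : Continuous fun ζ : Plane =>
        osc (ζ 0 * x 0 + ζ 1 * x 1)).aestronglyMeasurable
  · refine (mul_le_mul_of_nonneg_left (norm_add_le _ _) (by positivity)).trans ?_
    rw [mul_add]
    exact add_le_add (hC z w) (hC' z w)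
  · rw [add_sub_add_comm, add_mul]
    exact (norm_add_le _ _).trans (add_le_add (hD z w) (hD' z w))

theorem IsDilationKernel.const_mul {K : ℝ → ℝ → ℝ} {Q : ℝ → ℝ → ℂ} (h : IsDilationKernel K Q)
    (a : ℝ) : IsDilationKernel (fun x y => a * K x y) (fun z w => a * Q z w) := by
  obtain ⟨C, hC⟩ := h.decay
  obtain ⟨D, hD⟩ := h.regular
  refine ⟨fun s t hs ht => (h.integrable s t hs ht).const_mul a, continuous_const.mul h.continuous,
    fun s t hs ht x => ?_, ⟨|a| * C, fun z w => ?_⟩, ⟨|a| * D, fun z w => ?_⟩⟩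
  · simp_rw [Complex.ofReal_mul a, mul_assoc (a : ℂ), integral_const_mul]
    rw [← h.fourier s t hs ht]
    ring
  · rw [norm_mul, Complex.norm_real, Real.norm_eq_abs, mul_left_comm]
    exact mul_le_mul_of_nonneg_left (hC z w) (abs_nonneg a)
  · rw [← mul_sub, norm_mul, Complex.norm_real, Real.norm_eq_abs, mul_assoc]
    exact mul_le_mul_of_nonneg_left (hD z w) (abs_nonneg a)

theorem IsDilationKernel.sum {ι : Type*} (s : Finset ι) {K : ι → ℝ → ℝ → ℝ} {Q : ι → ℝ → ℝ → ℂ}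
    (h : ∀ i ∈ s, IsDilationKernel (K i) (Q i)) :
    IsDilationKernel (fun x y => ∑ i ∈ s, K i x y) (fun z w => ∑ i ∈ s, Q i z w) := by
  classical
  induction s using Finset.induction_on with
  | empty =>
    simpa using (isDilationKernel_weightedGaussian 0 0 0 0 one_pos one_pos).const_mul 0
  | insert i s hi ih =>
    simp only [Finset.sum_insert hi]
    exact (h i (Finset.mem_insert_self i s)).add
      (ih fun j hj => h j (Finset.mem_insert_of_mem hj))

end Kernels

/-! ### Summation over dyadic dilations -/

section DilationSums

theorem sum_Ico_int_sub (f : ℤ → ℝ) (a : ℤ) (m : ℕ) :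
    ∑ n ∈ Finset.Ico a (a + m), (f n - f (n + 1)) = f a - f (a + m) := by
  induction m with
  | zero => simp
  | succ m ih =>
    have h : Finset.Ico a (a + (m + 1 : ℕ)) = insert (a + (m : ℤ)) (Finset.Ico a (a + m)) := by
      ext n
      simp only [Finset.mem_Ico, Finset.mem_insert]
      omega
    rw [h, Finset.sum_insert (by simp), ih]
    push_cast
    rw [add_assoc]
    ring

/-- Terms bounded by `C ρ` and `C / ρ` along a sequence `ρ` that at least halves at each step have
bounded sums. -/
theorem sum_le_of_halving {C : ℝ} {c ρ : ℤ → ℝ} (hρ : ∀ n, 0 < ρ n)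
    (hhalf : ∀ n, ρ (n + 1) ≤ ρ n / 2) (h0 : ∀ n, 0 ≤ c n) (h1 : ∀ n, c n ≤ C * ρ n)
    (h2 : ∀ n, ρ n * c n ≤ C) (s : Finset ℤ) : ∑ n ∈ s, c n ≤ 6 * C := by
  have hC : 0 ≤ C := (mul_nonneg (hρ 0).le (h0 0)).trans (h2 0)
  -- The telescoping potential is t/(1+t), which increases from 0 to 1; its value at ρ/2 is ρ/(2+ρ).
  have hanti : ∀ n, ρ (n + 1) / (1 + ρ (n + 1)) ≤ ρ n / (2 + ρ n) := by
    intro n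
    have := hρ n
    have := hρ (n + 1)
    have := hhalf n
    rw [div_le_div_iff₀ (by positivity) (by positivity)]
    nlinarith
  have hterm : ∀ n, c n ≤ 6 * C * (ρ n / (1 + ρ n) - ρ (n + 1) / (1 + ρ (n + 1))) := by
    intro n
    have hn := hρ n
    have e : ρ n / (1 + ρ n) - ρ n / (2 + ρ n) = ρ n / ((1 + ρ n) * (2 + ρ n)) := by
      field_simp
      ring
    -- The two bounds also give c ≤ C, so in c(1+ρ)(2+ρ) = 2c + 3ρc + ρ²c the terms are at most 2Cρ,
    -- 3Cρ and Cρ; hence the 6.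
    have h3 : c n ≤ 6 * C * (ρ n / ((1 + ρ n) * (2 + ρ n))) := by
      rw [← mul_div_assoc, le_div_iff₀ (by positivity)]
      have h4 := h1 n
      have h5 := h2 n
      have h6 := mul_le_mul_of_nonneg_left h5 hn.le
      have h7 := h0 n
      nlinarith
    refine h3.trans (mul_le_mul_of_nonneg_left ?_ (by positivity))
    rw [← e]
    linarith [hanti n]
  obtain ⟨a, m, hs⟩ : ∃ (a : ℤ) (m : ℕ), s ⊆ Finset.Ico a (a + m) := by
    obtain ⟨a, ha⟩ := s.bddBelow
    obtain ⟨b, hb⟩ := s.bddAbove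
    refine ⟨a, (b + 1 - a).toNat, fun n hn => ?_⟩
    have h3 := ha hn
    have h4 := hb hn
    rw [Finset.mem_Ico]
    omega
  calc ∑ n ∈ s, c n ≤ ∑ n ∈ Finset.Ico a (a + m), c n :=
        Finset.sum_le_sum_of_subset_of_nonneg hs fun n _ _ => h0 n
    _ ≤ ∑ n ∈ Finset.Ico a (a + m),
          6 * C * (ρ n / (1 + ρ n) - ρ (n + 1) / (1 + ρ (n + 1))) :=
        Finset.sum_le_sum fun n _ => hterm n
    _ = 6 * C * (ρ a / (1 + ρ a) - ρ (a + m) / (1 + ρ (a + m))) := by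
        rw [← Finset.mul_sum, sum_Ico_int_sub fun n => ρ n / (1 + ρ n)]
    _ ≤ 6 * C * 1 := by
        refine mul_le_mul_of_nonneg_left ?_ (by positivity)
        have h3 : ρ a / (1 + ρ a) ≤ 1 := by
          rw [div_le_one (by linarith [hρ a])]
          linarith
        have h4 : 0 ≤ ρ (a + m) / (1 + ρ (a + m)) := by
          have := hρ (a + m)
          positivity
        linarith
    _ = 6 * C := mul_one _

/-- The dilation factor `2 ^ (k n)`. -/
noncomputable def dyadic (k : ℕ) (n : ℤ) : ℝ := (2 : ℝ) ^ ((k : ℤ) * n)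

theorem dyadic_pos (k : ℕ) (n : ℤ) : 0 < dyadic k n := by
  unfold dyadic
  positivity

theorem two_mul_dyadic_le {k : ℕ} (hk : 1 ≤ k) (n : ℤ) : 2 * dyadic k n ≤ dyadic k (n + 1) := by
  rw [dyadic, dyadic, mul_add, mul_one, zpow_add₀ two_ne_zero, mul_comm, zpow_natCast]
  refine mul_le_mul_of_nonneg_left ?_ (by positivity)
  exact le_self_pow₀ one_le_two (by omega)

variable {k l : ℕ} {K : ℝ → ℝ → ℝ} {Q : ℝ → ℝ → ℂ}

/-- With ρ_n the ℓ¹ size of the dilated point, regularity bounds the terms by a multiple of ρ_n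
(this needs Q(0,0) = 0) and decay by a multiple of 1/ρ_n. As k, l ≥ 1, ρ_n at least halves at each
step. -/
theorem IsDilationKernel.exists_sum_le (h : IsDilationKernel K Q) (hQ : Q 0 0 = 0) (hk : 1 ≤ k)
    (hl : 1 ≤ l) : ∃ C, 0 ≤ C ∧ ∀ (s : Finset ℤ) (x y : ℝ),
      ∑ n ∈ s, ‖Q (x / dyadic l n) (y / dyadic k n)‖ ≤ C := by
  obtain ⟨C, hC⟩ := h.decay
  obtain ⟨D, hD⟩ := h.regular
  rw [hQ] at hD
  simp only [sub_zero] at hD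
  refine ⟨6 * max |C| |D|, by positivity, fun s x y => ?_⟩
  -- At the origin ρ_n = 0, so the halving lemma does not apply, but every term is Q(0,0) = 0.
  by_cases hxy : x = 0 ∧ y = 0
  · rw [hxy.1, hxy.2]
    simp [hQ]
  refine sum_le_of_halving (ρ := fun n => |x / dyadic l n| + |y / dyadic k n|) (fun n => ?_)
    (fun n => ?_) (fun n => norm_nonneg _) (fun n => ?_) (fun n => ?_) s
  · have := (dyadic_pos l n).ne'
    have := (dyadic_pos k n).ne'
    rcases not_and_or.1 hxy with h | h
    · have : 0 < |x / dyadic l n| := abs_pos.2 (by positivity)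
      positivity
    · have : 0 < |y / dyadic k n| := abs_pos.2 (by positivity)
      positivity
  · have key : ∀ {j : ℕ} (_ : 1 ≤ j) (u : ℝ), |u / dyadic j (n + 1)| ≤ |u / dyadic j n| / 2 := by
      intro j hj u
      rw [abs_div, abs_div, abs_of_pos (dyadic_pos j _), abs_of_pos (dyadic_pos j _), div_div]
      refine div_le_div_of_nonneg_left (abs_nonneg u) (mul_pos (dyadic_pos j _) two_pos) ?_
      rw [mul_comm]
      exact two_mul_dyadic_le hj n
    rw [add_div]
    exact add_le_add (key hl x) (key hk y)
  · refine (hD _ _).trans (mul_le_mul_of_nonneg_right ?_ (by positivity))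
    exact (le_abs_self D).trans (le_max_right _ _)
  · exact (hC _ _).trans ((le_abs_self C).trans (le_max_left _ _))

theorem charFun_eq_integral_osc (ν : Measure Plane) (ζ : Plane) :
    charFun ν (-(2 * Real.pi) • ζ) = ∫ x, osc (ζ 0 * x 0 + ζ 1 * x 1) ∂ν := by
  rw [charFun_apply]
  refine integral_congr_ae (Filter.Eventually.of_forall fun x => ?_)
  simp only [osc]
  congr 1
  rw [inner_smul_right, mul_comm]
  congr 2
  simp [PiLp.inner_apply, Fin.sum_univ_two]

/-- Fubini moves the Fourier transform from ν to the kernel, so that only the mass of ν matters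
afterwards. -/
theorem IsDilationKernel.integral_mul_charFun (h : IsDilationKernel K Q) (ν : Measure Plane)
    [IsFiniteMeasure ν] {s t : ℝ} (hs : 0 < s) (ht : 0 < t) :
    s * t * ∫ ζ : Plane, (K (s * ζ 0) (t * ζ 1) : ℂ) * charFun ν (-(2 * Real.pi) • ζ) =
      ∫ x, Q (x 0 / s) (x 1 / t) ∂ν := by
  have hint : Integrable (fun p : Plane × Plane =>
      (K (s * p.1 0) (t * p.1 1) : ℂ) * osc (p.1 0 * p.2 0 + p.1 1 * p.2 1)) (volume.prod ν) := by
    have h1 := (h.integrable s t hs ht).ofReal (𝕜 := ℂ).mul_prod (integrable_const (1 : ℂ) (μ := ν))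
    simp only [mul_one] at h1
    exact Integrable.mul_bdd (c := 1) h1 (by fun_prop : Continuous fun p : Plane × Plane =>
        osc (p.1 0 * p.2 0 + p.1 1 * p.2 1)).aestronglyMeasurable
        (Filter.Eventually.of_forall fun x => (norm_osc _).le)
  have e : ∀ ζ : Plane, (K (s * ζ 0) (t * ζ 1) : ℂ) * charFun ν (-(2 * Real.pi) • ζ) =
      ∫ x, (K (s * ζ 0) (t * ζ 1) : ℂ) * osc (ζ 0 * x 0 + ζ 1 * x 1) ∂ν := fun ζ => by
    rw [charFun_eq_integral_osc, integral_const_mul]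
  simp_rw [e]
  rw [integral_integral_swap hint, ← integral_const_mul]
  refine integral_congr_ae (Filter.Eventually.of_forall fun x => ?_)
  exact h.fourier s t hs ht x

theorem IsDilationKernel.exists_sum_norm_integral_charFun_le (h : IsDilationKernel K Q)
    (hQ : Q 0 0 = 0) (hk : 1 ≤ k) (hl : 1 ≤ l) :
    ∃ C, 0 ≤ C ∧ ∀ (s : Finset ℤ) (ν : Measure Plane) [IsFiniteMeasure ν],
      ∑ n ∈ s, ‖(dyadic l n * dyadic k n : ℂ) * ∫ ζ : Plane,
        (K (dyadic l n * ζ 0) (dyadic k n * ζ 1) : ℂ) * charFun ν (-(2 * Real.pi) • ζ)‖ ≤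
        C * ν.real Set.univ := by
  obtain ⟨C, hC, hQC⟩ := h.exists_sum_le hQ hk hl
  refine ⟨C, hC, fun s ν _ => ?_⟩
  have hcont : ∀ n : ℤ, Continuous fun x : Plane => ‖Q (x 0 / dyadic l n) (x 1 / dyadic k n)‖ :=
    fun n => (h.continuous.comp (by fun_prop :
      Continuous fun x : Plane => (x 0 / dyadic l n, x 1 / dyadic k n))).norm
  have hint : ∀ n : ℤ, Integrable (fun x : Plane => ‖Q (x 0 / dyadic l n) (x 1 / dyadic k n)‖) ν := by
    intro n
    refine Integrable.of_bound (hcont n).aestronglyMeasurable C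
      (Filter.Eventually.of_forall fun x => ?_)
    rw [norm_norm]
    simpa using hQC {n} (x 0) (x 1)
  calc _ = ∑ n ∈ s, ‖∫ x, Q (x 0 / dyadic l n) (x 1 / dyadic k n) ∂ν‖ :=
        Finset.sum_congr rfl fun n _ => by
          rw [h.integral_mul_charFun ν (dyadic_pos l n) (dyadic_pos k n)]
    _ ≤ ∑ n ∈ s, ∫ x, ‖Q (x 0 / dyadic l n) (x 1 / dyadic k n)‖ ∂ν :=
        Finset.sum_le_sum fun n _ => norm_integral_le_integral_norm _
    _ = ∫ x, ∑ n ∈ s, ‖Q (x 0 / dyadic l n) (x 1 / dyadic k n)‖ ∂ν :=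
        (integral_finsetSum s fun n _ => hint n).symm
    _ ≤ ∫ _, C ∂ν :=
        integral_mono (integrable_finsetSum s fun n _ => hint n) (integrable_const C)
          fun x => hQC s (x 0) (x 1)
    _ = C * ν.real Set.univ := by rw [integral_const, smul_eq_mul, mul_comm]

open scoped ComplexConjugate

/-- Conjugation of the transform is reflection of the measure, and products correspond to
convolutions. This linearises the quadratic expression |φ̂|². -/
theorem charFun_mul_conj (ν ν' : Measure Plane) [IsFiniteMeasure ν] [IsFiniteMeasure ν'] (t : Plane) :
    charFun ν t * conj (charFun ν' t) =
      charFun (ν ∗ ν'.map fun x => (-1 : ℝ) • x) t := by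
  have : IsFiniteMeasure (ν'.map fun x => (-1 : ℝ) • x) := inferInstance
  rw [charFun_conv, charFun_map_smul, neg_one_smul, charFun_neg]

theorem complexFourier_mul_conj (μ μ' : ComplexMeasure Plane) (ζ : Plane) :
    complexFourier μ ζ * conj (complexFourier μ' ζ) =
      ∑ r : Fin 4, ∑ r' : Fin 4, (Complex.I ^ (r : ℕ) * conj (Complex.I ^ (r' : ℕ))) *
        charFun (jordanPart μ r ∗ (jordanPart μ' r').map fun x => (-1 : ℝ) • x)
          (-(2 * Real.pi) • ζ) := by
  rw [complexFourier, complexFourier, map_sum, Finset.sum_mul_sum]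
  refine Finset.sum_congr rfl fun r _ => Finset.sum_congr rfl fun r' _ => ?_
  rw [← charFun_mul_conj, map_mul]
  ring

theorem IsDilationKernel.integrable_mul_charFun (h : IsDilationKernel K Q) (ν : Measure Plane)
    [IsFiniteMeasure ν] {s t : ℝ} (hs : 0 < s) (ht : 0 < t) :
    Integrable fun ζ : Plane => (K (s * ζ 0) (t * ζ 1) : ℂ) * charFun ν (-(2 * Real.pi) • ζ) :=
  Integrable.mul_bdd (c := ν.real Set.univ) (h.integrable s t hs ht).ofReal
    (continuous_charFun.comp (continuous_const_smul _)).aestronglyMeasurable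
    (Filter.Eventually.of_forall fun _ => norm_charFun_le _)

theorem IsDilationKernel.integrable_mul_complexFourier (h : IsDilationKernel K Q)
    (μ μ' : ComplexMeasure Plane) {s t : ℝ} (hs : 0 < s) (ht : 0 < t) :
    Integrable fun ζ : Plane => (K (s * ζ 0) (t * ζ 1) : ℂ) *
      (complexFourier μ ζ * conj (complexFourier μ' ζ)) := by
  simp_rw [complexFourier_mul_conj, Finset.mul_sum, mul_left_comm _ (_ * _) (charFun _ _)]
  exact integrable_finsetSum _ fun r _ => integrable_finsetSum _ fun r' _ =>
    (h.integrable_mul_charFun _ hs ht).const_mul _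

/-- The product of transforms splits into 16 terms, one for each pair of Jordan parts, with
unimodular coefficients. Each is the transform of a convolution whose mass is at most the product of
the total variations. -/
theorem IsDilationKernel.exists_bilinear_bound (h : IsDilationKernel K Q)
    (hQ : Q 0 0 = 0) (hk : 1 ≤ k) (hl : 1 ≤ l) :
    ∃ C, 0 ≤ C ∧ ∀ (s : Finset ℤ) (μ μ' : ComplexMeasure Plane),
      ∑ n ∈ s, ‖(dyadic l n * dyadic k n : ℂ) * ∫ ζ : Plane,
        (K (dyadic l n * ζ 0) (dyadic k n * ζ 1) : ℂ) *
          (complexFourier μ ζ * conj (complexFourier μ' ζ))‖ ≤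
        C * (μ.variation.real Set.univ * μ'.variation.real Set.univ) := by
  obtain ⟨C, hC, hKC⟩ := h.exists_sum_norm_integral_charFun_le hQ hk hl
  refine ⟨16 * C, by positivity, fun s μ μ' => ?_⟩
  set ν : Fin 4 → Fin 4 → Measure Plane := fun r r' =>
    jordanPart μ r ∗ (jordanPart μ' r').map fun x => (-1 : ℝ) • x with hν
  have hfin : ∀ r r', IsFiniteMeasure (ν r r') := fun r r' => by
    rw [hν]
    infer_instance
  have hmass : ∀ r r', (ν r r').real Set.univ ≤
      μ.variation.real Set.univ * μ'.variation.real Set.univ := by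
    intro r r'
    have h1 : (ν r r').real Set.univ =
        (jordanPart μ r).real Set.univ * (jordanPart μ' r').real Set.univ := by
      -- At frequency 0 the characteristic functions are the masses.
      have h2 := charFun_mul_conj (jordanPart μ r) (jordanPart μ' r') 0
      rw [charFun_zero, charFun_zero, charFun_zero, Complex.conj_ofReal] at h2
      rw [← Complex.ofReal_mul] at h2
      exact (Complex.ofReal_injective h2).symm
    rw [h1]
    refine mul_le_mul ?_ ?_ measureReal_nonneg measureReal_nonneg
    · exact ENNReal.toReal_mono (measure_ne_top _ _) (jordanPart_le_variation μ r _)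
    · exact ENNReal.toReal_mono (measure_ne_top _ _) (jordanPart_le_variation μ' r' _)
  have hterm : ∀ n : ℤ, ‖(dyadic l n * dyadic k n : ℂ) * ∫ ζ : Plane,
        (K (dyadic l n * ζ 0) (dyadic k n * ζ 1) : ℂ) *
          (complexFourier μ ζ * conj (complexFourier μ' ζ))‖ ≤
      ∑ r : Fin 4, ∑ r' : Fin 4, ‖(dyadic l n * dyadic k n : ℂ) * ∫ ζ : Plane,
        (K (dyadic l n * ζ 0) (dyadic k n * ζ 1) : ℂ) *
          charFun (ν r r') (-(2 * Real.pi) • ζ)‖ := by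
    intro n
    have hi := fun r r' => h.integrable_mul_charFun (ν r r') (dyadic_pos l n) (dyadic_pos k n)
    simp_rw [complexFourier_mul_conj, Finset.mul_sum, mul_left_comm _ (_ * _) (charFun _ _)]
    rw [integral_finsetSum _ fun r _ => integrable_finsetSum _ fun r' _ => (hi r r').const_mul _,
      Finset.mul_sum]
    refine norm_sum_le_of_le _ fun r _ => ?_
    rw [integral_finsetSum _ fun r' _ => (hi r r').const_mul _, Finset.mul_sum]
    refine norm_sum_le_of_le _ fun r' _ => ?_
    rw [integral_const_mul, mul_left_comm, norm_mul]
    refine mul_le_of_le_one_left (norm_nonneg _) (le_of_eq ?_)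
    simp
  calc _ ≤ ∑ n ∈ s, ∑ r : Fin 4, ∑ r' : Fin 4, ‖(dyadic l n * dyadic k n : ℂ) * ∫ ζ : Plane,
        (K (dyadic l n * ζ 0) (dyadic k n * ζ 1) : ℂ) *
          charFun (ν r r') (-(2 * Real.pi) • ζ)‖ := Finset.sum_le_sum fun n _ => hterm n
    _ = ∑ r : Fin 4, ∑ r' : Fin 4, ∑ n ∈ s, ‖(dyadic l n * dyadic k n : ℂ) * ∫ ζ : Plane,
        (K (dyadic l n * ζ 0) (dyadic k n * ζ 1) : ℂ) *
          charFun (ν r r') (-(2 * Real.pi) • ζ)‖ := by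
        rw [Finset.sum_comm]
        exact Finset.sum_congr rfl fun r _ => Finset.sum_comm
    _ ≤ ∑ _ : Fin 4, ∑ _ : Fin 4, C * (μ.variation.real Set.univ * μ'.variation.real Set.univ) :=
        Finset.sum_le_sum fun r _ => Finset.sum_le_sum fun r' _ =>
          (hKC s (ν r r')).trans (mul_le_mul_of_nonneg_left (hmass r r') hC)
    _ = _ := by
        simp
        ring

end DilationSums

/-! ### Kernels with integral zero -/

section CancellingKernels

/-- A polynomial with prescribed values at the points `2 ^ (± l (q + 1))`. -/
theorem exists_interpolation {l : ℕ} (hl : 1 ≤ l) (L : ℕ) (α β : ℕ → ℝ) :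
    ∃ (d : ℕ) (c : ℕ → ℝ), ∀ q < L,
      ∑ i ∈ Finset.range d, c i * ((2 : ℝ) ^ (l * (q + 1)))⁻¹ ^ i = α q ∧
      ∑ i ∈ Finset.range d, c i * ((2 : ℝ) ^ (l * (q + 1))) ^ i = β q := by
  let v : ℤ → ℝ := fun e => (2 : ℝ) ^ ((l : ℤ) * e)
  -- Negative exponents carry the values α and positive ones β; the node e = 0 is spare and its
  -- value is irrelevant.
  let r : ℤ → ℝ := fun e => if e < 0 then α (-e - 1).toNat else β (e - 1).toNat
  let S : Finset ℤ := Finset.Icc (-L : ℤ) L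
  have hv : Set.InjOn v S := by
    intro a _ b _ hab
    have h1 := zpow_right_injective₀ (two_pos : (0 : ℝ) < 2) (by norm_num) hab
    exact mul_left_cancel₀ (by omega) h1
  let P : Polynomial ℝ := Lagrange.interpolate S v r
  refine ⟨P.natDegree + 1, P.coeff, fun q hq => ?_⟩
  rw [← Polynomial.eval_eq_sum_range, ← Polynomial.eval_eq_sum_range]
  constructor
  · have h1 := Lagrange.eval_interpolate_at_node r hv
      (show -((q : ℤ) + 1) ∈ S by rw [Finset.mem_Icc]; omega)
    have h2 : v (-((q : ℤ) + 1)) = ((2 : ℝ) ^ (l * (q + 1)))⁻¹ := by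
      simp only [v]
      rw [mul_neg, zpow_neg, ← zpow_natCast]
      push_cast
      rfl
    have h3 : r (-((q : ℤ) + 1)) = α q := by
      simp only [r]
      rw [if_pos (by omega)]
      congr 1
      omega
    rw [h2, h3] at h1
    exact h1
  · have h1 := Lagrange.eval_interpolate_at_node r hv
      (show ((q : ℤ) + 1) ∈ S by rw [Finset.mem_Icc]; omega)
    have h2 : v ((q : ℤ) + 1) = (2 : ℝ) ^ (l * (q + 1)) := by
      simp only [v]
      rw [← zpow_natCast]
      push_cast
      rfl
    have h3 : r ((q : ℤ) + 1) = β q := by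
      simp only [r]
      rw [if_neg (by omega)]
      congr 1
      omega
    rw [h2, h3] at h1
    exact h1

/-- The total integral of `|x| ^ p * x ^ n * exp (-x²)`. -/
noncomputable def gaussianMoment (p n : ℕ) : ℝ := ∫ x, weightedGaussian p n 1 x

/-- For even n the denominator is positive. For odd n the moment of order n is 0 by symmetry, and
the identity reads 0 = 0. -/
theorem gaussianMoment_div_mul (p n m : ℕ) :
    gaussianMoment p n / gaussianMoment p (n + 2 * m) * gaussianMoment p (n + 2 * m) =
      gaussianMoment p n := by
  rcases Nat.even_or_odd n with hn | hn
  · refine div_mul_cancel₀ _ (ne_of_gt ?_)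
    exact integral_weightedGaussian_pos p (hn.add (even_two_mul m)) one_pos
  · rw [gaussianMoment, integral_weightedGaussian_odd p hn, zero_div, zero_mul]

variable (k l M d : ℕ) (c : ℕ → ℝ)

/-- The function `|x|^(k-1) |y|^(l-1) (y^l)^q (x^k)^(-q-2) (x^(2kM) e^(-x²-y²) - E x y)`, where
`E x y = ∑ c_i x^(2kM) (2^i y)^(2lM) e^(-x²-(2^i y)²)`. -/
noncomputable def horizontalKernel (q : ℕ) (x y : ℝ) : ℝ :=
  weightedGaussian (k - 1) (k * (2 * M - q - 2)) 1 x * weightedGaussian (l - 1) (l * q) 1 y +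
    ∑ i ∈ Finset.range d, (-(c i * ((2 : ℝ) ^ i) ^ (2 * (l * M)))) *
      (weightedGaussian (k - 1) (k * (2 * M - q - 2)) 1 x *
        weightedGaussian (l - 1) (l * q + 2 * (l * M)) (((2 : ℝ) ^ i) ^ 2) y)

/-- The function `|x|^(k-1) |y|^(l-1) (x^k)^p (y^l)^(-p-2) (y^(2lM) e^(-x²-y²) + E x y)`, where
`E x y = ∑ c_i x^(2kM) (2^i y)^(2lM) e^(-x²-(2^i y)²)`. -/
noncomputable def verticalKernel (p : ℕ) (x y : ℝ) : ℝ :=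
  weightedGaussian (k - 1) (k * p) 1 x * weightedGaussian (l - 1) (l * (2 * M - p - 2)) 1 y +
    ∑ i ∈ Finset.range d, (c i * ((2 : ℝ) ^ i) ^ (2 * (l * M))) *
      (weightedGaussian (k - 1) (k * p + 2 * (k * M)) 1 x *
        weightedGaussian (l - 1) (l * (2 * M - p - 2)) (((2 : ℝ) ^ i) ^ 2) y)

/-- All terms share the same x-factor, so only the y-integrals have to cancel. Rescaling the i-th
one by 2^i, together with its prefactor 2^(2ilM), leaves the power 2^(-il(q+1)); `hc` is then the
cancellation. -/
theorem exists_horizontalKernel_transform {q : ℕ} (hl : 1 ≤ l)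
    (hc : ∑ i ∈ Finset.range d, c i * ((2 : ℝ) ^ (l * (q + 1)))⁻¹ ^ i =
      gaussianMoment (l - 1) (l * q) / gaussianMoment (l - 1) (l * q + 2 * (l * M))) :
    ∃ Q, IsDilationKernel (horizontalKernel k l M d c q) Q ∧ Q 0 0 = 0 := by
  have hpos : ∀ i : ℕ, (0 : ℝ) < ((2 : ℝ) ^ i) ^ 2 := fun i => by positivity
  refine ⟨_, (isDilationKernel_weightedGaussian _ _ _ _ one_pos one_pos).add
    (IsDilationKernel.sum (Finset.range d) fun i _ =>
      (isDilationKernel_weightedGaussian _ _ _ _ one_pos (hpos i)).const_mul _), ?_⟩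
  simp only [fourierLine_zero]
  have h2 := gaussianMoment_div_mul (l - 1) (l * q) (l * M)
  rw [← hc, Finset.sum_mul] at h2
  simp only [← Complex.ofReal_mul, ← Complex.ofReal_add, ← Complex.ofReal_sum]
  rw [Complex.ofReal_eq_zero]
  rw [← gaussianMoment, ← gaussianMoment, ← h2, Finset.mul_sum, ← Finset.sum_add_distrib]
  refine Finset.sum_eq_zero fun i _ => ?_
  rw [integral_weightedGaussian_scale _ _ (by positivity : (0 : ℝ) < 2 ^ i), ← gaussianMoment]
  have e : ((2 : ℝ) ^ i) ^ (l - 1 + (l * q + 2 * (l * M)) + 1) =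
      ((2 : ℝ) ^ i) ^ (2 * (l * M)) * (2 ^ (l * (q + 1))) ^ i := by
    rw [← pow_mul, ← pow_mul, ← pow_mul, ← pow_add]
    congr 1
    obtain ⟨l, rfl⟩ : ∃ l', l = l' + 1 := ⟨l - 1, by omega⟩
    simp only [Nat.add_sub_cancel]
    ring
  rw [e, mul_inv, inv_pow]
  have h3 : (((2 : ℝ) ^ i) ^ (2 * (l * M))) ≠ 0 := by positivity
  field_simp
  ring

/-- Here the x-moments differ, and rescaling the i-th y-integral leaves the positive power
2^(il(p+1)). Thus the two families of conditions use disjoint interpolation nodes. `hp` makes the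
truncated exponent 2M - p - 2 a true difference, which this power count needs. -/
theorem exists_verticalKernel_transform {p : ℕ} (hl : 1 ≤ l) (hp : p + 2 ≤ 2 * M)
    (hc : ∑ i ∈ Finset.range d, c i * ((2 : ℝ) ^ (l * (p + 1))) ^ i =
      -(gaussianMoment (k - 1) (k * p) / gaussianMoment (k - 1) (k * p + 2 * (k * M)))) :
    ∃ Q, IsDilationKernel (verticalKernel k l M d c p) Q ∧ Q 0 0 = 0 := by
  have hpos : ∀ i : ℕ, (0 : ℝ) < ((2 : ℝ) ^ i) ^ 2 := fun i => by positivity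
  refine ⟨_, (isDilationKernel_weightedGaussian _ _ _ _ one_pos one_pos).add
    (IsDilationKernel.sum (Finset.range d) fun i _ =>
      (isDilationKernel_weightedGaussian _ _ _ _ one_pos (hpos i)).const_mul _), ?_⟩
  simp only [fourierLine_zero]
  have h2 := gaussianMoment_div_mul (k - 1) (k * p) (k * M)
  rw [← neg_neg (_ / _), ← hc, neg_mul, Finset.sum_mul] at h2
  simp only [← Complex.ofReal_mul, ← Complex.ofReal_add, ← Complex.ofReal_sum]
  rw [Complex.ofReal_eq_zero]
  rw [← gaussianMoment, ← gaussianMoment, ← h2, neg_mul, Finset.sum_mul, neg_add_eq_zero]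
  refine Finset.sum_congr rfl fun i _ => ?_
  rw [integral_weightedGaussian_scale _ _ (by positivity : (0 : ℝ) < 2 ^ i), ← gaussianMoment,
    ← gaussianMoment]
  have e : ((2 : ℝ) ^ i) ^ (2 * (l * M)) =
      ((2 : ℝ) ^ i) ^ (l - 1 + (l * (2 * M - p - 2)) + 1) * (2 ^ (l * (p + 1))) ^ i := by
    rw [← pow_mul, ← pow_mul, ← pow_mul, ← pow_add]
    congr 1
    obtain ⟨l, rfl⟩ : ∃ l', l = l' + 1 := ⟨l - 1, by omega⟩
    obtain ⟨t, ht⟩ : ∃ t, 2 * M = t + p + 2 := ⟨2 * M - p - 2, by omega⟩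
    have h4 : 2 * ((l + 1) * M) = (l + 1) * (t + p + 2) := by rw [← ht]; ring
    rw [h4, ht, show t + p + 2 - p - 2 = t by omega]
    simp only [Nat.add_sub_cancel]
    ring
  rw [e]
  have h3 : (((2 : ℝ) ^ i) ^ (l - 1 + (l * (2 * M - p - 2)) + 1)) ≠ 0 := by positivity
  field_simp

/-- The correction that makes both kernels have integral zero. -/
noncomputable def correction (x y : ℝ) : ℝ :=
  ∑ i ∈ Finset.range d, c i * ((2 : ℝ) ^ i) ^ (2 * (l * M)) *
    (x ^ (2 * (k * M)) * y ^ (2 * (l * M)) * Real.exp (-x ^ 2 - (2 ^ i) ^ 2 * y ^ 2))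

variable {k l M}

/-- Since q + 2 ≤ 2M, the factor x^(2kM), present in the Gaussian term and in the correction,
absorbs the denominator x^(k(q+2)). -/
theorem pow_mul_horizontalKernel {q : ℕ} (hq : q + 2 ≤ 2 * M) (x y : ℝ) :
    x ^ (k * (q + 2)) * horizontalKernel k l M d c q x y =
      |x| ^ (k - 1) * |y| ^ (l - 1) * y ^ (l * q) *
        (x ^ (2 * (k * M)) * Real.exp (-x ^ 2 - y ^ 2) - correction k l M d c x y) := by
  have e1 : 2 * (k * M) = k * (q + 2) + k * (2 * M - q - 2) := by
    obtain ⟨t, ht⟩ : ∃ t, 2 * M = t + q + 2 := ⟨2 * M - q - 2, by omega⟩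
    rw [mul_left_comm, ht, show t + q + 2 - q - 2 = t by omega]
    ring
  rw [horizontalKernel, correction, mul_add (x ^ _), mul_sub, sub_eq_add_neg, Finset.mul_sum, Finset.mul_sum,
    ← Finset.sum_neg_distrib]
  congr 1
  · rw [weightedGaussian, weightedGaussian, sub_eq_add_neg, Real.exp_add, e1, pow_add]
    simp only [neg_one_mul]
    ring
  · refine Finset.sum_congr rfl fun i _ => ?_
    rw [weightedGaussian, weightedGaussian, sub_eq_add_neg, Real.exp_add, e1, pow_add x,
      pow_add y (l * q)]
    simp only [neg_mul, one_mul]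
    ring

theorem pow_mul_verticalKernel {p : ℕ} (hp : p + 2 ≤ 2 * M) (x y : ℝ) :
    y ^ (l * (p + 2)) * verticalKernel k l M d c p x y =
      |x| ^ (k - 1) * |y| ^ (l - 1) * x ^ (k * p) *
        (y ^ (2 * (l * M)) * Real.exp (-x ^ 2 - y ^ 2) + correction k l M d c x y) := by
  have e1 : y ^ (2 * (l * M)) = y ^ (l * (p + 2)) * y ^ (l * (2 * M - p - 2)) := by
    obtain ⟨t, ht⟩ : ∃ t, 2 * M = t + p + 2 := ⟨2 * M - p - 2, by omega⟩
    rw [← pow_add, mul_left_comm, ht, show t + p + 2 - p - 2 = t by omega]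
    ring_nf
  rw [verticalKernel, correction, mul_add (y ^ _), mul_add (_ * x ^ _), Finset.mul_sum, Finset.mul_sum]
  congr 1
  · rw [weightedGaussian, weightedGaussian, sub_eq_add_neg, Real.exp_add, e1]
    simp only [neg_one_mul]
    ring
  · refine Finset.sum_congr rfl fun i _ => ?_
    rw [weightedGaussian, weightedGaussian, sub_eq_add_neg, Real.exp_add, e1, pow_add x (k * p)]
    simp only [neg_mul, one_mul]
    ring

end CancellingKernels

/-! ### Quadratic forms in the transforms, and a lower bound for the bumps -/

section WeightedEstimate

open scoped ComplexConjugate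

/-- The weights ρ_i will be the monomial quotients of the solution formulas, for which ρ_i ρ_j
depends only on i + j; hence one kernel for each value of i + j suffices. -/
theorem ofReal_mul_norm_sq_sum {J : ℕ} (γ m : ℕ → ℂ) (ρ κ : ℕ → ℝ) (w : ℝ)
    (hκ : ∀ i < J, ∀ j < J, κ (i + j) = w * (ρ i * ρ j)) :
    ((w * ‖∑ i ∈ Finset.range J, γ i * (ρ i : ℂ) * m i‖ ^ 2 : ℝ) : ℂ) =
      ∑ i ∈ Finset.range J, ∑ j ∈ Finset.range J,
        (γ i * conj (γ j)) * ((κ (i + j) : ℂ) * (m i * conj (m j))) := by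
  rw [Complex.ofReal_mul, Complex.ofReal_pow, ← Complex.mul_conj', map_sum, Finset.sum_mul_sum,
    Finset.mul_sum]
  refine Finset.sum_congr rfl fun i hi => ?_
  rw [Finset.mul_sum]
  refine Finset.sum_congr rfl fun j hj => ?_
  rw [hκ i (Finset.mem_range.1 hi) j (Finset.mem_range.1 hj)]
  simp only [map_mul, Complex.conj_ofReal]
  push_cast
  ring

/-- The hermitian form with the kernels `K (i + j)`, dilated by `2 ^ n`. -/
noncomputable def dilatedForm (k l J : ℕ) (γ : ℕ → ℂ) (K : ℕ → ℝ → ℝ → ℝ)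
    (μ : ℕ → ComplexMeasure Plane) (n : ℤ) (ζ : Plane) : ℂ :=
  ∑ i ∈ Finset.range J, ∑ j ∈ Finset.range J, (γ i * conj (γ j)) *
    (((dyadic l n * dyadic k n * K (i + j) (dyadic l n * ζ 0) (dyadic k n * ζ 1) : ℝ) : ℂ) *
      (complexFourier (μ i) ζ * conj (complexFourier (μ j) ζ)))

theorem exists_dilatedForm_bound {k l : ℕ} (hk : 1 ≤ k) (hl : 1 ≤ l) (J : ℕ) (γ : ℕ → ℂ)
    {K : ℕ → ℝ → ℝ → ℝ}
    (hK : ∀ q, q + 2 ≤ 2 * J → ∃ Q, IsDilationKernel (K q) Q ∧ Q 0 0 = 0) :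
    ∃ C, 0 ≤ C ∧ ∀ μ : ℕ → ComplexMeasure Plane,
      (∀ n, Integrable (dilatedForm k l J γ K μ n)) ∧
      ∀ s : Finset ℤ, ∑ n ∈ s, ‖∫ ζ, dilatedForm k l J γ K μ n ζ‖ ≤
        C * (∑ i ∈ Finset.range J, (μ i).variation.real Set.univ) ^ 2 := by
  have hK' : ∀ q, ∃ C, q + 2 ≤ 2 * J → 0 ≤ C ∧ ∀ (s : Finset ℤ) (μ μ' : ComplexMeasure Plane),
      ∑ n ∈ s, ‖(dyadic l n * dyadic k n : ℂ) * ∫ ζ : Plane,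
        (K q (dyadic l n * ζ 0) (dyadic k n * ζ 1) : ℂ) *
          (complexFourier μ ζ * conj (complexFourier μ' ζ))‖ ≤
        C * (μ.variation.real Set.univ * μ'.variation.real Set.univ) := by
    intro q
    by_cases h : q + 2 ≤ 2 * J
    · obtain ⟨Q, hQ, hQ0⟩ := hK q h
      obtain ⟨C, hC⟩ := hQ.exists_bilinear_bound hQ0 hk hl
      exact ⟨C, fun _ => hC⟩
    · exact ⟨0, fun h' => absurd h' h⟩
  choose C hC using hK'
  set D : ℝ := ∑ i ∈ Finset.range J, ∑ j ∈ Finset.range J, ‖γ i * conj (γ j)‖ * C (i + j) with hD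
  have hC0 : ∀ i ∈ Finset.range J, ∀ j ∈ Finset.range J, 0 ≤ ‖γ i * conj (γ j)‖ * C (i + j) := by
    intro i hi j hj
    rw [Finset.mem_range] at hi hj
    exact mul_nonneg (norm_nonneg _) (hC (i + j) (by omega)).1
  have hDle : ∀ i ∈ Finset.range J, ∀ j ∈ Finset.range J, ‖γ i * conj (γ j)‖ * C (i + j) ≤ D := by
    intro i hi j hj
    refine (Finset.single_le_sum (f := fun j => ‖γ i * conj (γ j)‖ * C (i + j)) (hC0 i hi) hj).trans ?_
    exact Finset.single_le_sum
      (f := fun i => ∑ j ∈ Finset.range J, ‖γ i * conj (γ j)‖ * C (i + j))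
      (fun i hi => Finset.sum_nonneg (hC0 i hi)) hi
  refine ⟨D, Finset.sum_nonneg fun i hi => Finset.sum_nonneg (hC0 i hi), fun μ => ?_⟩
  set V : ℕ → ℝ := fun i => (μ i).variation.real Set.univ with hV
  have hint : ∀ n, ∀ i ∈ Finset.range J, ∀ j ∈ Finset.range J, Integrable fun ζ : Plane =>
      (γ i * conj (γ j)) *
      (((dyadic l n * dyadic k n * K (i + j) (dyadic l n * ζ 0) (dyadic k n * ζ 1) : ℝ) : ℂ) *
        (complexFourier (μ i) ζ * conj (complexFourier (μ j) ζ))) := by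
    intro n i hi j hj
    rw [Finset.mem_range] at hi hj
    obtain ⟨Q, hQ, _⟩ := hK (i + j) (by omega)
    refine Integrable.const_mul ?_ _
    simp_rw [Complex.ofReal_mul (_ * _), mul_assoc ((_ * _ : ℝ) : ℂ)]
    exact (hQ.integrable_mul_complexFourier (μ i) (μ j) (dyadic_pos l n) (dyadic_pos k n)).const_mul _
  refine ⟨fun n => integrable_finsetSum _ fun i hi => integrable_finsetSum _ fun j hj =>
    hint n i hi j hj, fun s => ?_⟩
  have hterm : ∀ n, ‖∫ ζ, dilatedForm k l J γ K μ n ζ‖ ≤ ∑ i ∈ Finset.range J, ∑ j ∈ Finset.range J,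
      ‖γ i * conj (γ j)‖ * ‖(dyadic l n * dyadic k n : ℂ) * ∫ ζ : Plane,
        (K (i + j) (dyadic l n * ζ 0) (dyadic k n * ζ 1) : ℂ) *
          (complexFourier (μ i) ζ * conj (complexFourier (μ j) ζ))‖ := by
    intro n
    unfold dilatedForm
    rw [integral_finsetSum _ fun i hi => integrable_finsetSum _ fun j hj => hint n i hi j hj]
    refine norm_sum_le_of_le _ fun i hi => ?_
    rw [integral_finsetSum _ fun j hj => hint n i hi j hj]
    refine norm_sum_le_of_le _ fun j hj => ?_
    rw [integral_const_mul, norm_mul]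
    simp_rw [Complex.ofReal_mul (_ * _), mul_assoc ((_ * _ : ℝ) : ℂ)]
    rw [integral_const_mul]
    push_cast
    exact le_rfl
  calc _ ≤ ∑ n ∈ s, ∑ i ∈ Finset.range J, ∑ j ∈ Finset.range J,
      ‖γ i * conj (γ j)‖ * ‖(dyadic l n * dyadic k n : ℂ) * ∫ ζ : Plane,
        (K (i + j) (dyadic l n * ζ 0) (dyadic k n * ζ 1) : ℂ) *
          (complexFourier (μ i) ζ * conj (complexFourier (μ j) ζ))‖ :=
        Finset.sum_le_sum fun n _ => hterm n
    _ = ∑ i ∈ Finset.range J, ∑ j ∈ Finset.range J,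
      ‖γ i * conj (γ j)‖ * ∑ n ∈ s, ‖(dyadic l n * dyadic k n : ℂ) * ∫ ζ : Plane,
        (K (i + j) (dyadic l n * ζ 0) (dyadic k n * ζ 1) : ℂ) *
          (complexFourier (μ i) ζ * conj (complexFourier (μ j) ζ))‖ := by
        rw [Finset.sum_comm]
        refine Finset.sum_congr rfl fun i _ => ?_
        rw [Finset.sum_comm]
        refine Finset.sum_congr rfl fun j _ => ?_
        rw [Finset.mul_sum]
    _ ≤ ∑ i ∈ Finset.range J, ∑ j ∈ Finset.range J, D * (V i * V j) := by
        refine Finset.sum_le_sum fun i hi => Finset.sum_le_sum fun j hj => ?_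
        have h1 : i + j + 2 ≤ 2 * J := by
          rw [Finset.mem_range] at hi hj
          omega
        refine (mul_le_mul_of_nonneg_left ((hC (i + j) h1).2 s (μ i) (μ j)) (norm_nonneg _)).trans ?_
        rw [← mul_assoc]
        exact mul_le_mul_of_nonneg_right (hDle i hi j hj)
          (mul_nonneg measureReal_nonneg measureReal_nonneg)
    _ = D * (∑ i ∈ Finset.range J, V i) ^ 2 := by
        rw [sq, Finset.sum_mul_sum, Finset.mul_sum]
        exact Finset.sum_congr rfl fun i _ => (Finset.mul_sum _ _ _).symm

theorem dyadic_pow_comm (k l : ℕ) (n : ℤ) : dyadic l n ^ k = dyadic k n ^ l := by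
  rw [dyadic, dyadic, ← zpow_natCast, ← zpow_natCast, ← zpow_mul, ← zpow_mul]
  congr 1
  ring

variable {k l M : ℕ} (d : ℕ) (c : ℕ → ℝ)

/-- When s^k = t^l, the factor |x|^(k-1) |y|^(l-1) y^(lq) / x^(k(q+2)) is multiplied by (st)⁻¹ under
(x, y) ↦ (sx, ty), and the L¹ normalisation st undoes this. This is where the exponents of the
Sobolev weight are forced. -/
theorem horizontalKernel_dilate (hk : 1 ≤ k) (hl : 1 ≤ l) {s t : ℝ} (hs : 0 < s) (ht : 0 < t)
    (hst : s ^ k = t ^ l) {q : ℕ} (hq : q + 2 ≤ 2 * M) {x : ℝ} (hx : x ≠ 0) (y : ℝ) :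
    s * t * horizontalKernel k l M d c q (s * x) (t * y) =
      |x| ^ (k - 1) * |y| ^ (l - 1) * ((s * x) ^ (2 * (k * M)) *
        Real.exp (-(s * x) ^ 2 - (t * y) ^ 2) - correction k l M d c (s * x) (t * y)) *
        (y ^ (l * q) / x ^ (k * (q + 2))) := by
  have h := pow_mul_horizontalKernel (k := k) (l := l) d c hq (s * x) (t * y)
  set P := (s * x) ^ (2 * (k * M)) *
        Real.exp (-(s * x) ^ 2 - (t * y) ^ 2) - correction k l M d c (s * x) (t * y)
  set H := horizontalKernel k l M d c q (s * x) (t * y)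
  have h1 : s * s ^ (k - 1) = s ^ k := mul_pow_sub_one (by omega) s
  have h2 : t * t ^ (l - 1) = s ^ k := hst ▸ mul_pow_sub_one (by omega) t
  have h3 : t ^ (l * q) = (s ^ k) ^ q := by rw [pow_mul, hst]
  rw [abs_mul, abs_mul, abs_of_pos hs, abs_of_pos ht, mul_pow, mul_pow, mul_pow, mul_pow t, h3,
    pow_mul s] at h
  rw [← mul_div_assoc, eq_div_iff (pow_ne_zero _ hx)]
  refine mul_left_cancel₀ (pow_ne_zero (q + 2) (pow_ne_zero k hs.ne')) ?_
  calc (s ^ k) ^ (q + 2) * (s * t * H * x ^ (k * (q + 2))) =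
        s * t * ((s ^ k) ^ (q + 2) * x ^ (k * (q + 2)) * H) := by ring
    _ = (s * s ^ (k - 1)) * (t * t ^ (l - 1)) * (s ^ k) ^ q *
          (|x| ^ (k - 1) * |y| ^ (l - 1) * P * y ^ (l * q)) := by
        rw [h]
        ring
    _ = _ := by
        rw [h1, h2]
        ring

theorem verticalKernel_dilate (hk : 1 ≤ k) (hl : 1 ≤ l) {s t : ℝ} (hs : 0 < s) (ht : 0 < t)
    (hst : s ^ k = t ^ l) {p : ℕ} (hp : p + 2 ≤ 2 * M) (x : ℝ) {y : ℝ} (hy : y ≠ 0) :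
    s * t * verticalKernel k l M d c p (s * x) (t * y) =
      |x| ^ (k - 1) * |y| ^ (l - 1) * ((t * y) ^ (2 * (l * M)) *
        Real.exp (-(s * x) ^ 2 - (t * y) ^ 2) + correction k l M d c (s * x) (t * y)) *
        (x ^ (k * p) / y ^ (l * (p + 2))) := by
  have h := pow_mul_verticalKernel (k := k) (l := l) d c hp (s * x) (t * y)
  set P := (t * y) ^ (2 * (l * M)) *
        Real.exp (-(s * x) ^ 2 - (t * y) ^ 2) + correction k l M d c (s * x) (t * y)
  set H := verticalKernel k l M d c p (s * x) (t * y)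
  have h1 : s * s ^ (k - 1) = s ^ k := mul_pow_sub_one (by omega) s
  have h2 : t * t ^ (l - 1) = s ^ k := hst ▸ mul_pow_sub_one (by omega) t
  have h3 : t ^ (l * (p + 2)) = (s ^ k) ^ (p + 2) := by rw [pow_mul, hst]
  rw [abs_mul, abs_mul, abs_of_pos hs, abs_of_pos ht, mul_pow, mul_pow, mul_pow, mul_pow s, h3,
    pow_mul s] at h
  rw [← mul_div_assoc, eq_div_iff (pow_ne_zero _ hy)]
  refine mul_left_cancel₀ (pow_ne_zero (p + 2) (pow_ne_zero k hs.ne')) ?_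
  calc (s ^ k) ^ (p + 2) * (s * t * H * y ^ (l * (p + 2))) =
        s * t * ((s ^ k) ^ (p + 2) * y ^ (l * (p + 2)) * H) := by ring
    _ = (s * s ^ (k - 1)) * (t * t ^ (l - 1)) * (s ^ k) ^ p *
          (|x| ^ (k - 1) * |y| ^ (l - 1) * P * x ^ (k * p)) := by
        rw [h]
        ring
    _ = _ := by
        rw [h1, h2]
        ring

/-- The sum over the dilations of this function is bounded below off the axes. -/
noncomputable def dilationBump (k l M : ℕ) (x y : ℝ) : ℝ :=
  (x ^ (2 * (k * M)) + y ^ (2 * (l * M))) * Real.exp (-x ^ 2 - y ^ 2)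

theorem dilationBump_nonneg (x y : ℝ) : 0 ≤ dilationBump k l M x y := by
  unfold dilationBump
  have h1 := (even_two_mul (k * M)).pow_nonneg x
  have h2 := (even_two_mul (l * M)).pow_nonneg y
  positivity

theorem exists_le_dilationBump (hk : 1 ≤ k) (hl : 1 ≤ l) {x : ℝ} (hx : x ≠ 0) (y : ℝ) :
    ∃ n : ℤ, Real.exp (-(2 ^ l) ^ 2 - (2 ^ k) ^ 2) ≤
      dilationBump k l M (dyadic l n * x) (dyadic k n * y) := by
  have hpos : 0 < max (|x| ^ k) (|y| ^ l) := lt_max_of_lt_left (pow_pos (abs_pos.2 hx) k)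
  have h2 : (1 : ℝ) < 2 ^ (k * l) := one_lt_pow₀ one_lt_two (by positivity)
  -- One dilation step multiplies both |x|^k and |y|^l by 2^(kl). Taking n = -m brings their maximum
  -- into [1, 2^(kl)): the lower end makes the polynomial factor at least 1, and the upper end
  -- bounds the Gaussian from below.
  obtain ⟨m, hm1, hm2⟩ := exists_mem_Ico_zpow hpos h2
  have hd : dyadic l (-m) ^ k = (((2 : ℝ) ^ (k * l)) ^ m)⁻¹ := by
    rw [dyadic, ← zpow_neg, ← zpow_natCast, ← zpow_natCast, ← zpow_mul, ← zpow_mul]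
    congr 1
    push_cast
    ring
  have hx' : |dyadic l (-m) * x| ^ k = (((2 : ℝ) ^ (k * l)) ^ m)⁻¹ * |x| ^ k := by
    rw [abs_mul, abs_of_pos (dyadic_pos _ _), mul_pow, hd]
  have hy' : |dyadic k (-m) * y| ^ l = (((2 : ℝ) ^ (k * l)) ^ m)⁻¹ * |y| ^ l := by
    rw [abs_mul, abs_of_pos (dyadic_pos _ _), mul_pow, ← dyadic_pow_comm, hd]
  set X := dyadic l (-m) * x
  set Y := dyadic k (-m) * y
  have hT : (0 : ℝ) < ((2 : ℝ) ^ (k * l)) ^ m := by positivity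
  have hup : ∀ u : ℝ, u ≤ max (|x| ^ k) (|y| ^ l) → (((2 : ℝ) ^ (k * l)) ^ m)⁻¹ * u ≤ 2 ^ (k * l) := by
    intro u hu
    rw [inv_mul_le_iff₀ hT]
    rw [zpow_add_one₀ (by positivity)] at hm2
    exact hu.trans hm2.le
  have hX : |X| ≤ 2 ^ l := by
    have h3 := hup _ (le_max_left _ _)
    rw [← hx', mul_comm k l, pow_mul] at h3
    exact (pow_le_pow_iff_left₀ (abs_nonneg _) (by positivity) (by omega)).1 h3
  have hY : |Y| ≤ 2 ^ k := by
    have h3 := hup _ (le_max_right _ _)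
    rw [← hy', pow_mul] at h3
    exact (pow_le_pow_iff_left₀ (abs_nonneg _) (by positivity) (by omega)).1 h3
  have hX0 : 0 ≤ X ^ (2 * (k * M)) := (even_two_mul _).pow_nonneg X
  have hY0 : 0 ≤ Y ^ (2 * (l * M)) := (even_two_mul _).pow_nonneg Y
  have hone : 1 ≤ X ^ (2 * (k * M)) + Y ^ (2 * (l * M)) := by
    have key : ∀ (u : ℝ) (j : ℕ), 1 ≤ |u| ^ j → 1 ≤ u ^ (2 * (j * M)) := by
      intro u j hu
      have e : u ^ (2 * (j * M)) = (|u| ^ j) ^ (2 * M) := by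
        rw [← pow_mul, ← (even_two_mul (j * M)).pow_abs]
        congr 1
        ring
      rw [e]
      exact one_le_pow₀ hu
    have hlow : ∀ u : ℝ, max (|x| ^ k) (|y| ^ l) = u → 1 ≤ (((2 : ℝ) ^ (k * l)) ^ m)⁻¹ * u := by
      intro u hu
      rw [le_inv_mul_iff₀ hT, mul_one, ← hu]
      exact hm1
    rcases max_choice (|x| ^ k) (|y| ^ l) with h | h
    · have := key X k (hx' ▸ hlow _ h)
      linarith
    · have := key Y l (hy' ▸ hlow _ h)
      linarith
  refine ⟨-m, ?_⟩
  have hexp : Real.exp (-(2 ^ l) ^ 2 - (2 ^ k) ^ 2) ≤ Real.exp (-X ^ 2 - Y ^ 2) := by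
    refine Real.exp_le_exp.2 ?_
    have h3 := pow_le_pow_left₀ (abs_nonneg X) hX 2
    have h4 := pow_le_pow_left₀ (abs_nonneg Y) hY 2
    rw [sq_abs] at h3 h4
    linarith
  exact hexp.trans (le_mul_of_one_le_left (Real.exp_pos _).le hone)

end WeightedEstimate

/-! ### The weighted L² bound from two representations -/

section CoreEstimate

theorem ae_coords_ne_zero : ∀ᵐ ζ : Plane, ζ 0 ≠ 0 ∧ ζ 1 ≠ 0 := by
  have h0 : ∀ᵐ p : ℝ × ℝ, p.1 ≠ 0 :=
    Measure.quasiMeasurePreserving_fst.ae (Measure.ae_ne volume (0 : ℝ))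
  have h1 : ∀ᵐ p : ℝ × ℝ, p.2 ≠ 0 :=
    Measure.quasiMeasurePreserving_snd.ae (Measure.ae_ne volume (0 : ℝ))
  exact measurePreserving_coords.quasiMeasurePreserving.ae (h0.and h1)

/-- A nonnegative function is integrable if its products with a family of bumps that cover the
space have summable integrals. -/
theorem lintegral_le_of_bumps {X ι : Type*} [MeasurableSpace X] {ν : Measure X} [Countable ι]
    {w : X → ℝ} {b : ι → X → ℝ} {G : ι → X → ℂ} {e B : ℝ} (he : 0 < e) (hw : AEMeasurable w ν)
    (hw0 : ∀ x, 0 ≤ w x) (hb0 : ∀ n x, 0 ≤ b n x) (hG : ∀ n, Integrable (G n) ν)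
    (hwG : ∀ n, ∀ᵐ x ∂ν, ((w x * b n x : ℝ) : ℂ) = G n x)
    (hB : ∀ s : Finset ι, ∑ n ∈ s, ‖∫ x, G n x ∂ν‖ ≤ B) (hb : ∀ᵐ x ∂ν, ∃ n, e ≤ b n x) :
    ∫⁻ x, ENNReal.ofReal (w x) ∂ν ≤ ENNReal.ofReal (B / e) := by
  have hwint : ∀ n, Integrable (fun x => w x * b n x) ν := fun n =>
    (hG n).re.congr ((hwG n).mono fun x h => by
      change (G n x).re = _
      rw [← h, Complex.ofReal_re])
  have hlint : ∀ n, ∫⁻ x, ENNReal.ofReal (w x * b n x) ∂ν ≤ ENNReal.ofReal ‖∫ x, G n x ∂ν‖ := by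
    intro n
    rw [← ofReal_integral_eq_lintegral_ofReal (hwint n)
      (Filter.Eventually.of_forall fun x => mul_nonneg (hw0 x) (hb0 n x))]
    refine ENNReal.ofReal_le_ofReal ?_
    rw [← integral_congr_ae (hwG n), integral_complex_ofReal, Complex.norm_real]
    exact le_abs_self _
  have hsum : ∀ s : Finset ι, ∑ n ∈ s, ∫⁻ x, ENNReal.ofReal (w x * b n x) ∂ν ≤
      ENNReal.ofReal B := by
    intro s
    refine (Finset.sum_le_sum fun n _ => hlint n).trans ?_
    rw [← ENNReal.ofReal_sum_of_nonneg fun n _ => norm_nonneg _]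
    exact ENNReal.ofReal_le_ofReal (hB s)
  have hmeas : ∀ n, AEMeasurable (fun x => ENNReal.ofReal (w x * b n x)) ν := fun n =>
    (hwint n).aestronglyMeasurable.aemeasurable.ennreal_ofReal
  rw [ENNReal.ofReal_div_of_pos he, ENNReal.le_div_iff_mul_le (Or.inl (by simpa using he))
    (Or.inl ENNReal.ofReal_ne_top), mul_comm, ← lintegral_const_mul'' _ hw.ennreal_ofReal]
  calc ∫⁻ x, ENNReal.ofReal e * ENNReal.ofReal (w x) ∂ν ≤
        ∫⁻ x, ∑' n, ENNReal.ofReal (w x * b n x) ∂ν := by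
        refine lintegral_mono_ae ?_
        filter_upwards [hb] with x ⟨n, hn⟩
        refine le_trans ?_ (ENNReal.le_tsum n)
        rw [← ENNReal.ofReal_mul he.le, mul_comm]
        exact ENNReal.ofReal_le_ofReal (mul_le_mul_of_nonneg_left hn (hw0 x))
    _ = ∑' n, ∫⁻ x, ENNReal.ofReal (w x * b n x) ∂ν := lintegral_tsum hmeas
    _ ≤ _ := by
        rw [ENNReal.tsum_eq_iSup_sum]
        exact iSup_le hsum

/-- The two forms carry the two parts of the bump, each paired with the representation whose
denominators it can absorb. The correction enters with opposite signs and drops out because both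
multiply the same |z|². -/
theorem weight_mul_dilationBump_eq {k l M : ℕ} (hk : 1 ≤ k) (hl : 1 ≤ l) {J J' : ℕ} (hJ : J ≤ M)
    (hJ' : J' ≤ M) (d : ℕ) (c : ℕ → ℝ) (γ γ' : ℕ → ℂ) (μ μ' : ℕ → ComplexMeasure Plane) (n : ℤ)
    {ζ : Plane} (h0 : ζ 0 ≠ 0) (h1 : ζ 1 ≠ 0) {z : ℂ}
    (hz : z = ∑ i ∈ Finset.range J, γ i *
      ((ζ 1 ^ (l * i) / ζ 0 ^ (k * (i + 1)) : ℝ) : ℂ) * complexFourier (μ i) ζ)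
    (hz' : z = ∑ i ∈ Finset.range J', γ' i *
      ((ζ 0 ^ (k * i) / ζ 1 ^ (l * (i + 1)) : ℝ) : ℂ) * complexFourier (μ' i) ζ) :
    ((|ζ 0| ^ (k - 1) * |ζ 1| ^ (l - 1) * ‖z‖ ^ 2 *
        dilationBump k l M (dyadic l n * ζ 0) (dyadic k n * ζ 1) : ℝ) : ℂ) =
      dilatedForm k l J γ (horizontalKernel k l M d c) μ n ζ +
        dilatedForm k l J' γ' (verticalKernel k l M d c) μ' n ζ := by
  have hst := dyadic_pow_comm k l n
  have hs := dyadic_pos l n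
  have ht := dyadic_pos k n
  rw [dilatedForm, dilatedForm]
  set s := dyadic l n
  set t := dyadic k n
  have hA := ofReal_mul_norm_sq_sum (J := J) γ (fun i => complexFourier (μ i) ζ)
    (fun i => ζ 1 ^ (l * i) / ζ 0 ^ (k * (i + 1)))
    (fun q => s * t * horizontalKernel k l M d c q (s * ζ 0) (t * ζ 1))
    (|ζ 0| ^ (k - 1) * |ζ 1| ^ (l - 1) * ((s * ζ 0) ^ (2 * (k * M)) *
      Real.exp (-(s * ζ 0) ^ 2 - (t * ζ 1) ^ 2) - correction k l M d c (s * ζ 0) (t * ζ 1)))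
    (fun i hi j hj => by
      rw [horizontalKernel_dilate d c hk hl hs ht hst (by omega) h0, div_mul_div_comm,
        ← pow_add, ← pow_add, ← mul_add, ← mul_add, show i + 1 + (j + 1) = i + j + 2 by ring])
  have hB := ofReal_mul_norm_sq_sum (J := J') γ' (fun i => complexFourier (μ' i) ζ)
    (fun i => ζ 0 ^ (k * i) / ζ 1 ^ (l * (i + 1)))
    (fun q => s * t * verticalKernel k l M d c q (s * ζ 0) (t * ζ 1))
    (|ζ 0| ^ (k - 1) * |ζ 1| ^ (l - 1) * ((t * ζ 1) ^ (2 * (l * M)) *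
      Real.exp (-(s * ζ 0) ^ 2 - (t * ζ 1) ^ 2) + correction k l M d c (s * ζ 0) (t * ζ 1)))
    (fun i hi j hj => by
      rw [verticalKernel_dilate d c hk hl hs ht hst (by omega) _ h1, div_mul_div_comm,
        ← pow_add, ← pow_add, ← mul_add, ← mul_add, show i + 1 + (j + 1) = i + j + 2 by ring])
  rw [← hA, ← hB, ← hz, ← hz', ← Complex.ofReal_add, dilationBump]
  congr 1
  ring

/-- If a function has two representations by Fourier transforms of measures, one singular on the
vertical axis and one singular on the horizontal axis, then it is in the weighted `L²` space. -/
theorem exists_weighted_bound {k l : ℕ} (hk : 1 ≤ k) (hl : 1 ≤ l) (J J' : ℕ) (γ γ' : ℕ → ℂ) :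
    ∃ C : ℝ, 0 ≤ C ∧ ∀ (μ μ' : ℕ → ComplexMeasure Plane) (F : Plane → ℂ),
      AEStronglyMeasurable F volume →
      (∀ᵐ ζ : Plane, F ζ = ∑ i ∈ Finset.range J, γ i *
        ((ζ 1 ^ (l * i) / ζ 0 ^ (k * (i + 1)) : ℝ) : ℂ) * complexFourier (μ i) ζ) →
      (∀ᵐ ζ : Plane, F ζ = ∑ i ∈ Finset.range J', γ' i *
        ((ζ 0 ^ (k * i) / ζ 1 ^ (l * (i + 1)) : ℝ) : ℂ) * complexFourier (μ' i) ζ) →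
      ∫⁻ ζ : Plane, ENNReal.ofReal (|ζ 0| ^ (k - 1) * |ζ 1| ^ (l - 1) * ‖F ζ‖ ^ 2) ≤
        ENNReal.ofReal (C * (∑ i ∈ Finset.range J, (μ i).variation.real Set.univ +
          ∑ i ∈ Finset.range J', (μ' i).variation.real Set.univ) ^ 2) := by
  -- Any M at least J and J' works: the kernels that occur have index q with q + 2 ≤ 2J or q + 2 ≤
  -- 2J', hence q < 2M.
  set M := J + J' with hM
  obtain ⟨d, c, hc⟩ := exists_interpolation hl (2 * M)
    (fun q => gaussianMoment (l - 1) (l * q) / gaussianMoment (l - 1) (l * q + 2 * (l * M)))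
    (fun p => -(gaussianMoment (k - 1) (k * p) / gaussianMoment (k - 1) (k * p + 2 * (k * M))))
  obtain ⟨A, hA, hAμ⟩ := exists_dilatedForm_bound hk hl J γ
    (K := horizontalKernel k l M d c) fun q hq =>
      exists_horizontalKernel_transform k l M d c hl (hc q (by omega)).1
  obtain ⟨B, hB, hBμ⟩ := exists_dilatedForm_bound hk hl J' γ'
    (K := verticalKernel k l M d c) fun p hp =>
      exists_verticalKernel_transform k l M d c hl (by omega) (hc p (by omega)).2
  set e : ℝ := Real.exp (-(2 ^ l) ^ 2 - (2 ^ k) ^ 2) with he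
  have hepos : 0 < e := Real.exp_pos _
  refine ⟨(A + B) / e, by positivity, fun μ μ' F hF hFA hFB => ?_⟩
  obtain ⟨hAint, hAsum⟩ := hAμ μ
  obtain ⟨hBint, hBsum⟩ := hBμ μ'
  set V := ∑ i ∈ Finset.range J, (μ i).variation.real Set.univ with hV
  set V' := ∑ i ∈ Finset.range J', (μ' i).variation.real Set.univ with hV'
  have hV0 : 0 ≤ V := Finset.sum_nonneg fun _ _ => measureReal_nonneg
  have hV0' : 0 ≤ V' := Finset.sum_nonneg fun _ _ => measureReal_nonneg
  have hwm : AEMeasurable (fun ζ : Plane => |ζ 0| ^ (k - 1) * |ζ 1| ^ (l - 1) * ‖F ζ‖ ^ 2) volume :=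
    (by fun_prop : Continuous fun ζ : Plane => |ζ 0| ^ (k - 1) * |ζ 1| ^ (l - 1)).aemeasurable.mul
      (hF.norm.aemeasurable.pow_const 2)
  have hsum : ∀ s : Finset ℤ, ∑ n ∈ s,
      ‖∫ ζ, (dilatedForm k l J γ (horizontalKernel k l M d c) μ n ζ +
        dilatedForm k l J' γ' (verticalKernel k l M d c) μ' n ζ)‖ ≤ (A + B) * (V + V') ^ 2 := by
    intro s
    calc _ ≤ ∑ n ∈ s,
          (‖∫ ζ, dilatedForm k l J γ (horizontalKernel k l M d c) μ n ζ‖ +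
            ‖∫ ζ, dilatedForm k l J' γ' (verticalKernel k l M d c) μ' n ζ‖) := by
          refine Finset.sum_le_sum fun n _ => ?_
          rw [integral_add (hAint n) (hBint n)]
          exact norm_add_le _ _
      _ ≤ A * V ^ 2 + B * V' ^ 2 := by
          rw [Finset.sum_add_distrib]
          exact add_le_add (hAsum s) (hBsum s)
      _ ≤ A * (V + V') ^ 2 + B * (V + V') ^ 2 := by
          exact add_le_add (mul_le_mul_of_nonneg_left (pow_le_pow_left₀ hV0
            (le_add_of_nonneg_right hV0') 2) hA) (mul_le_mul_of_nonneg_left (pow_le_pow_left₀ hV0'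
            (le_add_of_nonneg_left hV0) 2) hB)
      _ = _ := (add_mul _ _ _).symm
  rw [div_mul_eq_mul_div]
  refine lintegral_le_of_bumps hepos hwm
    (fun ζ => mul_nonneg (mul_nonneg (by positivity) (by positivity)) (sq_nonneg _))
    (fun n ζ => dilationBump_nonneg (k := k) (l := l) (M := M) (dyadic l n * ζ 0) (dyadic k n * ζ 1))
    (fun n => (hAint n).add (hBint n)) (fun n => ?_) hsum ?_
  · filter_upwards [hFA, hFB, ae_coords_ne_zero] with ζ h1 h2 h3
    exact weight_mul_dilationBump_eq hk hl (by omega) (by omega) d c γ γ' μ μ' n h3.1 h3.2 h1 h2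
  · filter_upwards [ae_coords_ne_zero] with ζ h
    exact exists_le_dilationBump hk hl h.1 (ζ 1)

end CoreEstimate

/-! ### Solving the system from both ends -/

section System

theorem eq_neg_sum_of_system {a b : ℂ} (ha : a ≠ 0) {N : ℕ} {f m : ℕ → ℂ} (h0 : -(a * f 1) = m 0)
    (hm : ∀ j ∈ Finset.Icc 1 (N - 1), b * f j - a * f (j + 1) = m j) {j : ℕ} (hj : 1 ≤ j)
    (hjN : j ≤ N) : f j = ∑ i ∈ Finset.range j, -(b ^ i / a ^ (i + 1)) * m (j - 1 - i) := by
  induction j, hj using Nat.le_induction with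
  | base =>
    rw [Finset.sum_range_one, ← h0]
    field_simp
    ring
  | succ j hj ih =>
    have h1 := hm j (Finset.mem_Icc.2 ⟨hj, by omega⟩)
    have h2 : f (j + 1) = b / a * f j - m j / a := by
      rw [← h1]
      field_simp
      ring
    rw [h2, ih (by omega), Finset.sum_range_succ', Finset.mul_sum, sub_eq_add_neg]
    congr 1
    · refine Finset.sum_congr rfl fun i _ => ?_
      rw [show j + 1 - 1 - (i + 1) = j - 1 - i by omega]
      field_simp
      ring
    · rw [show j + 1 - 1 - 0 = j by omega]
      field_simp
      ring

theorem eq_sum_of_system {a b : ℂ} (hb : b ≠ 0) {N : ℕ} {f m : ℕ → ℂ} (hN : b * f N = m N)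
    (hm : ∀ j ∈ Finset.Icc 1 (N - 1), b * f j - a * f (j + 1) = m j) {j : ℕ} (hj : 1 ≤ j)
    (hjN : j ≤ N) : f j = ∑ i ∈ Finset.range (N + 1 - j), (a ^ i / b ^ (i + 1)) * m (j + i) := by
  induction hjN using Nat.decreasingInduction with
  | self =>
    rw [show N + 1 - N = 1 by omega, Finset.sum_range_one, add_zero, ← hN]
    field_simp
    ring
  | of_succ j hjN ih =>
    have h1 := hm j (Finset.mem_Icc.2 ⟨hj, by omega⟩)
    have h2 : f j = a / b * f (j + 1) + m j / b := by
      rw [← h1]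
      field_simp
      ring
    rw [h2, ih (by omega), show N + 1 - j = N + 1 - (j + 1) + 1 by omega, Finset.sum_range_succ',
      Finset.mul_sum]
    congr 1
    · refine Finset.sum_congr rfl fun i _ => ?_
      rw [show j + 1 + i = j + (i + 1) by omega]
      field_simp
      ring
    · rw [add_zero]
      field_simp
      ring

theorem enorm_weight_mul_sq {k l : ℕ} (hk : 1 ≤ k) (hl : 1 ≤ l) (x y : ℝ) (z : ℂ) :
    ‖((|x| ^ (((k : ℝ) - 1) / 2) * |y| ^ (((l : ℝ) - 1) / 2) : ℝ) : ℂ) * z‖ₑ ^ (2 : ℝ) =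
      ENNReal.ofReal (|x| ^ (k - 1) * |y| ^ (l - 1) * ‖z‖ ^ 2) := by
  have key : ∀ {j : ℕ} (_ : 1 ≤ j) (u : ℝ), (|u| ^ (((j : ℝ) - 1) / 2)) ^ 2 = |u| ^ (j - 1) := by
    intro j hj u
    rw [← Real.rpow_natCast, ← Real.rpow_mul (abs_nonneg u), ← Real.rpow_natCast, Nat.cast_sub hj]
    congr 1
    push_cast
    ring
  rw [← ofReal_norm, ENNReal.ofReal_rpow_of_nonneg (norm_nonneg _) two_pos.le, norm_mul,
    Complex.norm_real, Real.norm_of_nonneg (by positivity), Real.rpow_two, mul_pow, mul_pow, key hk,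
    key hl]

theorem eLpNorm_weight_mul_le {k l : ℕ} (hk : 1 ≤ k) (hl : 1 ≤ l) {F : Plane → ℂ} {C S : ℝ}
    (hC : 0 ≤ C) (hS : 0 ≤ S)
    (h : ∫⁻ ζ : Plane, ENNReal.ofReal (|ζ 0| ^ (k - 1) * |ζ 1| ^ (l - 1) * ‖F ζ‖ ^ 2) ≤
      ENNReal.ofReal (C * S ^ 2)) :
    eLpNorm (fun ζ : Plane => ((|ζ 0| ^ (((k : ℝ) - 1) / 2) * |ζ 1| ^ (((l : ℝ) - 1) / 2) : ℝ) : ℂ) *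
      F ζ) 2 volume ≤ ENNReal.ofReal (√C * S) := by
  rw [eLpNorm_eq_lintegral_rpow_enorm_toReal two_ne_zero ENNReal.ofNat_ne_top, ENNReal.toReal_ofNat]
  simp_rw [enorm_weight_mul_sq hk hl]
  refine (ENNReal.rpow_le_rpow h (by norm_num)).trans (le_of_eq ?_)
  rw [ENNReal.ofReal_rpow_of_nonneg (by positivity) (by norm_num), ← Real.sqrt_eq_rpow,
    Real.sqrt_mul hC, Real.sqrt_sq hS]

/-- The upward solution for index j uses μ_0, …, μ_{j-1} and the downward one μ_j, …, μ_N, so each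
measure is counted exactly once. -/
theorem sum_split_eq (V : ℕ → ℝ) {j N : ℕ} (hjN : j ≤ N + 1) :
    ∑ i ∈ Finset.range j, V (j - 1 - i) + ∑ i ∈ Finset.range (N + 1 - j), V (j + i) =
      ∑ i ∈ Finset.Icc 0 N, V i := by
  rw [Finset.sum_range_reflect, ← Finset.sum_Ico_eq_sum_range, Finset.sum_range_add_sum_Ico _ hjN]
  congr 1
  ext i
  simp only [Finset.mem_range, Finset.mem_Icc]
  omega

/-- The Fourier transforms of the solutions of the system are bounded in the weighted `L²` space. -/
theorem exists_system_bound {k l N : ℕ} (hk : 1 ≤ k) (hl : 1 ≤ l) {j : ℕ} (hj : 1 ≤ j)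
    (hjN : j ≤ N) :
    ∃ C : ℝ≥0, ∀ (μ : ℕ → ComplexMeasure Plane) (F : ℕ → Plane → ℂ),
      AEStronglyMeasurable (F j) volume →
      (∀ᵐ ζ : Plane, -((2 * Real.pi * Complex.I * ζ 0) ^ k * F 1 ζ) = complexFourier (μ 0) ζ ∧
        (∀ j ∈ Finset.Icc 1 (N - 1), (2 * Real.pi * Complex.I * ζ 1) ^ l * F j ζ -
          (2 * Real.pi * Complex.I * ζ 0) ^ k * F (j + 1) ζ = complexFourier (μ j) ζ) ∧
        (2 * Real.pi * Complex.I * ζ 1) ^ l * F N ζ = complexFourier (μ N) ζ) →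
      eLpNorm (fun ζ : Plane =>
        ((|ζ 0| ^ (((k : ℝ) - 1) / 2) * |ζ 1| ^ (((l : ℝ) - 1) / 2) : ℝ) : ℂ) * F j ζ) 2 volume ≤
          (C : ℝ≥0∞) * ∑ i ∈ Finset.Icc 0 N, totalVariationNorm (μ i) := by
  set τ : ℂ := 2 * Real.pi * Complex.I with hτ
  have hτ0 : τ ≠ 0 := Complex.two_pi_I_ne_zero
  -- The powers of 2πi go into the constant coefficients, so that only real monomial quotients
  -- remain.
  obtain ⟨C, hC, hbound⟩ := exists_weighted_bound hk hl j (N + 1 - j)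
    (fun i => -((τ ^ l) ^ i / (τ ^ k) ^ (i + 1))) (fun i => (τ ^ k) ^ i / (τ ^ l) ^ (i + 1))
  refine ⟨(√C).toNNReal, fun μ F hF hsys => ?_⟩
  have h := hbound (fun i => μ (j - 1 - i)) (fun i => μ (j + i)) (F j) hF
    (by
      filter_upwards [hsys, ae_coords_ne_zero] with ζ ⟨h0, hm, _⟩ hζ
      have ha : (τ * ζ 0) ^ k ≠ 0 :=
        pow_ne_zero _ (mul_ne_zero hτ0 (Complex.ofReal_ne_zero.2 hζ.1))
      refine (eq_neg_sum_of_system (N := N) (f := fun j => F j ζ)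
        (m := fun j => complexFourier (μ j) ζ) ha h0 hm hj hjN).trans
        (Finset.sum_congr rfl fun i _ => ?_)
      push_cast
      rw [mul_pow τ, mul_pow τ, mul_pow (τ ^ _), mul_pow (τ ^ _), pow_mul, pow_mul, mul_div_mul_comm, neg_mul, neg_mul,
        neg_mul])
    (by
      filter_upwards [hsys, ae_coords_ne_zero] with ζ ⟨_, hm, hN⟩ hζ
      have hb : (τ * ζ 1) ^ l ≠ 0 :=
        pow_ne_zero _ (mul_ne_zero hτ0 (Complex.ofReal_ne_zero.2 hζ.2))
      refine (eq_sum_of_system (N := N) (f := fun j => F j ζ)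
        (m := fun j => complexFourier (μ j) ζ) hb hN hm hj hjN).trans
        (Finset.sum_congr rfl fun i _ => ?_)
      push_cast
      rw [mul_pow τ, mul_pow τ, mul_pow (τ ^ _), mul_pow (τ ^ _), pow_mul, pow_mul, mul_div_mul_comm])
  rw [sum_split_eq (fun i => (μ i).variation.real Set.univ) (by omega)] at h
  refine (eLpNorm_weight_mul_le hk hl hC
    (Finset.sum_nonneg fun _ _ => measureReal_nonneg) h).trans (le_of_eq ?_)
  rw [ENNReal.ofReal_mul (Real.sqrt_nonneg C), ENNReal.ofReal_sum_of_nonneg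
    fun _ _ => measureReal_nonneg]
  congr 1
  exact Finset.sum_congr rfl fun i _ => ofReal_measureReal

end System

/-! ### Assembling the components -/

theorem theorem3 (k l N : ℕ) (hk : 1 ≤ k) (hl : 1 ≤ l) (hN : 1 ≤ N) (hodd : Odd k ∨ Odd l) :
    ∃ C : ℝ≥0, ∀ (φ : ℕ → PlaneDistribution) (μ : ℕ → ComplexMeasure Plane),
      (∀ j ∈ Finset.Icc 1 N, HasCompactDSupport (φ j)) →
      (∀ j ∈ Finset.Icc 0 N, IsCompactlySupportedMeasure (μ j)) →
      EqMeasure (-partial₁ k (φ 1)) (μ 0) →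
      (∀ j ∈ Finset.Icc 1 (N - 1),
        EqMeasure (partial₂ l (φ j) - partial₁ k (φ (j + 1))) (μ j)) →
      EqMeasure (partial₂ l (φ N)) (μ N) →
      (∀ j ∈ Finset.Icc 1 N, MemSobolevSpace (((k : ℝ) - 1) / 2) (((l : ℝ) - 1) / 2) (φ j)) ∧
      ∑ j ∈ Finset.Icc 1 N, sobolevNorm (((k : ℝ) - 1) / 2) (((l : ℝ) - 1) / 2) (φ j) ≤
        (C : ℝ≥0∞) * ∑ j ∈ Finset.Icc 0 N, totalVariationNorm (μ j) := by

  have hC : ∀ j, ∃ C : ℝ≥0, j ∈ Finset.Icc 1 N → ∀ (μ : ℕ → ComplexMeasure Plane)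
      (F : ℕ → Plane → ℂ), AEStronglyMeasurable (F j) volume →
      (∀ᵐ ζ : Plane, -((2 * Real.pi * Complex.I * ζ 0) ^ k * F 1 ζ) = complexFourier (μ 0) ζ ∧
        (∀ j ∈ Finset.Icc 1 (N - 1), (2 * Real.pi * Complex.I * ζ 1) ^ l * F j ζ -
          (2 * Real.pi * Complex.I * ζ 0) ^ k * F (j + 1) ζ = complexFourier (μ j) ζ) ∧
        (2 * Real.pi * Complex.I * ζ 1) ^ l * F N ζ = complexFourier (μ N) ζ) →
      eLpNorm (fun ζ : Plane =>
        ((|ζ 0| ^ (((k : ℝ) - 1) / 2) * |ζ 1| ^ (((l : ℝ) - 1) / 2) : ℝ) : ℂ) * F j ζ) 2 volume ≤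
          (C : ℝ≥0∞) * ∑ i ∈ Finset.Icc 0 N, totalVariationNorm (μ i) := by
    intro j
    by_cases h : j ∈ Finset.Icc 1 N
    · obtain ⟨h1, h2⟩ := Finset.mem_Icc.1 h
      obtain ⟨C, hC⟩ := exists_system_bound hk hl h1 h2
      exact ⟨C, fun _ => hC⟩
    · exact ⟨0, fun h' => absurd h' h⟩
  choose C hC using hC
  -- Each component is bounded by the full sum of total variations, so the constants add up.
  refine ⟨∑ j ∈ Finset.Icc 1 N, C j, fun φ μ hφ hμ h0 hj hlast => ?_⟩
  obtain ⟨F, hF, hsys⟩ := exists_fourier_system hN hφ hμ h0 hj hlast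
  have hmeas : ∀ j ∈ Finset.Icc 1 N, AEStronglyMeasurable (F j) volume := fun j hj =>
    (hF j hj).1.aestronglyMeasurable
  have hbound := fun j hj => hC j hj μ F (hmeas j hj) hsys
  have hfin : ∑ i ∈ Finset.Icc 0 N, totalVariationNorm (μ i) < ∞ :=
    ENNReal.sum_lt_top.2 fun i _ => measure_lt_top _ _
  refine ⟨fun j hj => ⟨F j, hF j hj, ?_, (hbound j hj).trans_lt
    (ENNReal.mul_lt_top ENNReal.coe_lt_top hfin)⟩, ?_⟩
  · have hcont : Continuous fun ζ : Plane =>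
        |ζ 0| ^ (((k : ℝ) - 1) / 2) * |ζ 1| ^ (((l : ℝ) - 1) / 2) := by
      have hk' : (0 : ℝ) ≤ ((k : ℝ) - 1) / 2 := by
        have : (1 : ℝ) ≤ k := by exact_mod_cast hk
        linarith
      have hl' : (0 : ℝ) ≤ ((l : ℝ) - 1) / 2 := by
        have : (1 : ℝ) ≤ l := by exact_mod_cast hl
        linarith
      exact ((by fun_prop : Continuous fun ζ : Plane => |ζ 0|).rpow_const fun _ => Or.inr hk').mul
        ((by fun_prop : Continuous fun ζ : Plane => |ζ 1|).rpow_const fun _ => Or.inr hl')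
    exact (Complex.continuous_ofReal.comp hcont).aestronglyMeasurable.mul (hmeas j hj)
  · push_cast
    rw [Finset.sum_mul]
    exact Finset.sum_le_sum fun j hj => (iInf₂_le (F j) (hF j hj)).trans (hbound j hj)
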